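/- **Model.** Let $k\ge 1$, let $\Omega=(\Omega_1,\dots,\Omega_k)$ be a probability distribution on $\{1,\dots,k\}$, let $D$ be the largest $d$ with $\Omega_d>0$, and let $n\ge 0$ be a real number such that $p_d=n\Omega_d/\binom{k}{d}\le 1$ for $1\le d\le k$. In the Poisson model for LT codes, every nonempty set of $d$ of the $k$ input symbols is, independently, the neighbourhood of a received output symbol with probability $p_d$. The belief propagation decoder maintains the set of decoded input symbols (initially empty); the *ripple* is the set of undecoded input symbols that are the only undecoded neighbour of some received output symbol. As long as the ripple is nonempty, one of its elements, selected by an arbitrary fixed rule from the set of decoded symbols and the ripple, is decoded. The *error probability* is the probability that the decoder stops before all input symbols are decoded. Let $X_u$ be the size of the ripple after $k-u$ steps, i.e. when $u$ symbols are undecoded ($X_u=0$ if the decoder has stopped before), and put $Q(u,r)=\Pr[X_u=r]$, $$q_u=1-\prod_{d=2}^{\min\{D,\,k-u+2\}}(1-p_d)^{\binom{k-u}{d-2}}\quad(1\le u\le k),\qquad Q_u(x)=\sum_{r=1}^{u}Q(u,r)\,x^{r-1}.$$ **Generating polynomials.** For every selection rule and every real $x\ne0$, $$Q_k(x)=\frac1x\bigl((p_1x+(1-p_1))^k-(1-p_1)^k\bigr),$$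 and for $1\le u\le k$ and every real $x\neq 0$ with $q_ux+1-q_u\ne0$, $$Q_{u-1}(x)=\frac{(q_ux+1-q_u)^{u-1}}{x}\,Q_u\Bigl(\frac{x}{q_ux+1-q_u}\Bigr)-\frac{(1-q_u)^{u-1}}{x}\,Q_u(0).$$ The error probability is $Q(1,0)$, and $Q_1$ is constant, equal to the success probability $1-Q(1,0)$. **Complexity.** Operations are counted on a real random access machine with unit cost: its index registers hold natural numbers, with constants, addition and truncated subtraction; its memory cells, addressed through the index registers, hold real numbers, with natural-number constants, copying, $+,-,\times$ and division by nonzero numbers; the control structures are sequencing, branching and loops on comparisons. Every instruction and every test counts as one operation. The input is $(k,n,\Omega_1,\dots,\Omega_k)$. 1. There are a program, the same for all inputs, and an absolute constant $c$ such that on every input as above the program halts with $q_1,\dots,q_k$ in memory, after at most $c\,Dk\log k$ operations if $k\ge2$. 2. There are a program, the same for all inputs, and an absolute constant $c$ such that on every input as above the program halts with the error probability in memory, after at most $c\,k^2\log k$ operations if $k\ge2$. 3. This bound is of smaller order than the bound $n^3\log^2 n$ of the algorithm of Karp, Luby and Shokrollahi when the number of output symbols is at least the number of input symbols: if $\nu_k\ge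 k$ is real for every $k$, then $k^2\log k=o(\nu_k^3\log^2\nu_k)$ as $k\to\infty$. -/

import Mathlib

open Finset

noncomputable section

namespace LTCode

/-! ## The Poisson model -/

/-- The probability `p_d = n Ω_d / binom(k, d)` that the output symbol which represents a given set
of `d` input symbols is received. -/
def recvProb (k : ℕ) (n : ℝ) (Ω : ℕ → ℝ) (d : ℕ) : ℝ :=
  n * Ω d / (k.choose d : ℝ)

/-- `Ω` is a probability distribution on `{1, …, k}` (extended by zero), and `n ≥ 0` is such that
every `p_d` is a probability. -/
structure IsPoissonModel (k : ℕ) (n : ℝ) (Ω : ℕ → ℝ) : Prop where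
  nonneg : ∀ d, 0 ≤ Ω d
  support : ∀ d, d ∉ Icc 1 k → Ω d = 0
  sum_eq_one : ∑ d ∈ Icc 1 k, Ω d = 1
  mean_nonneg : 0 ≤ n
  recvProb_le_one : ∀ d ∈ Icc 1 k, recvProb k n Ω d ≤ 1

/-- The largest degree of positive probability. -/
def maxDegree (k : ℕ) (Ω : ℕ → ℝ) : ℕ :=
  ((Icc 1 k).filter fun d => 0 < Ω d).sup id

/-- The factor graph: the family of the neighbourhoods of the received output symbols.
The input symbols are the elements of `Fin k`. -/
abbrev FactorGraph (k : ℕ) := Finset (Finset (Fin k))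

/-- The probability of a factor graph: each set `S` of input symbols is received with probability
`p_{|S|}`, independently of the others (`p_0 = 0`, so the empty set is never received). -/
def graphWeight (k : ℕ) (n : ℝ) (Ω : ℕ → ℝ) (G : FactorGraph k) : ℝ :=
  ∏ S : Finset (Fin k), if S ∈ G then recvProb k n Ω #S else 1 - recvProb k n Ω #S

/-- The probability of an event in the Poisson model. -/
def prob (k : ℕ) (n : ℝ) (Ω : ℕ → ℝ) (E : FactorGraph k → Prop) [DecidablePred E] : ℝ :=
  ∑ G ∈ univ.filter E, graphWeight k n Ω G

/-! ## Decoding by belief propagation -/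

/-- The ripple when the input symbols in `A` are decoded: the input symbols that are the only
undecoded neighbour of some received output symbol. -/
def ripple {k : ℕ} (G : FactorGraph k) (A : Finset (Fin k)) : Finset (Fin k) :=
  univ.filter fun a => ∃ S ∈ G, S \ A = {a}

/-- A rule which selects the symbol of the ripple that is decoded next, from the set of decoded
symbols and the (nonempty) ripple. -/
def IsSelectionRule {k : ℕ} (sel : Finset (Fin k) → Finset (Fin k) → Fin k) : Prop :=
  ∀ A R : Finset (Fin k), R.Nonempty → sel A R ∈ R

/-- The set of decoded input symbols after `t` steps of the decoder; the decoder stops when the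
ripple is empty. -/
def decoded {k : ℕ} (sel : Finset (Fin k) → Finset (Fin k) → Fin k) (G : FactorGraph k) :
    ℕ → Finset (Fin k)
  | 0 => ∅
  | t + 1 =>
    if (ripple G (decoded sel G t)).Nonempty then
      insert (sel (decoded sel G t) (ripple G (decoded sel G t))) (decoded sel G t)
    else decoded sel G t

/-- `X_u`: the size of the ripple when `u` symbols are undecoded, that is, after `k - u` steps
(and `0` if the decoder has stopped before). -/
def rippleSize {k : ℕ} (sel : Finset (Fin k) → Finset (Fin k) → Fin k) (G : FactorGraph k)
    (u : ℕ) : ℕ :=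
  #(ripple G (decoded sel G (k - u)))

/-- `Q(u, r) = Pr[X_u = r]`. -/
def Q (k : ℕ) (n : ℝ) (Ω : ℕ → ℝ) (sel : Finset (Fin k) → Finset (Fin k) → Fin k)
    (u r : ℕ) : ℝ :=
  prob k n Ω fun G => rippleSize sel G u = r

/-- The probability of error: the decoder does not recover all input symbols. -/
def errorProb (k : ℕ) (n : ℝ) (Ω : ℕ → ℝ) (sel : Finset (Fin k) → Finset (Fin k) → Fin k) : ℝ :=
  prob k n Ω fun G => decoded sel G k ≠ univ

/-- `q_u = 1 - ∏_{d = 2}^{min(D, k - u + 2)} (1 - p_d) ^ binom(k - u, d - 2)`. -/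
def joinProb (k : ℕ) (n : ℝ) (Ω : ℕ → ℝ) (u : ℕ) : ℝ :=
  1 - ∏ d ∈ Icc 2 (min (maxDegree k Ω) (k - u + 2)),
    (1 - recvProb k n Ω d) ^ (k - u).choose (d - 2)

/-- The generating polynomial `Q_u(x) = ∑_{r = 1}^{u} Q(u, r) x^{r - 1}`. -/
def genPoly (k : ℕ) (n : ℝ) (Ω : ℕ → ℝ) (sel : Finset (Fin k) → Finset (Fin k) → Fin k)
    (u : ℕ) : Polynomial ℝ :=
  ∑ r ∈ Icc 1 u, Polynomial.C (Q k n Ω sel u r) * Polynomial.X ^ (r - 1)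

end LTCode

/-! ## The machine model: a real random access machine with unit cost -/

namespace RealRAM

/-- Index registers hold natural numbers; memory cells hold real numbers. -/
structure State where
  idx : ℕ → ℕ
  mem : ℕ → ℝ

/-- The arithmetic operations on real numbers. -/
inductive ArithOp where
  | add
  | sub
  | mul
  | div

def ArithOp.eval : ArithOp → ℝ → ℝ → ℝ
  | .add, x, y => x + y
  | .sub, x, y => x - y
  | .mul, x, y => x * y
  | .div, x, y => x / y

/-- The instructions, where `I` are the index registers and `M` is the memory:
`I[i] := c`, `I[i] := I[j] + I[l]`, `I[i] := I[j] - I[l]` (truncated at zero),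
`M[I[i]] := c`, `M[I[i]] := M[I[j]]`, `M[I[i]] := M[I[j]] op M[I[l]]`. -/
inductive Instr where
  | idxConst (i c : ℕ)
  | idxAdd (i j l : ℕ)
  | idxSub (i j l : ℕ)
  | memConst (i c : ℕ)
  | memCopy (i j : ℕ)
  | memArith (op : ArithOp) (i j l : ℕ)

/-- An instruction can be executed unless it is a division by zero. -/
def Instr.Defined (s : State) : Instr → Prop
  | .memArith .div _ _ l => s.mem (s.idx l) ≠ 0
  | _ => True

/-- The effect of an instruction. -/
def Instr.run (s : State) : Instr → State
  | .idxConst i c => ⟨Function.update s.idx i c, s.mem⟩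
  | .idxAdd i j l => ⟨Function.update s.idx i (s.idx j + s.idx l), s.mem⟩
  | .idxSub i j l => ⟨Function.update s.idx i (s.idx j - s.idx l), s.mem⟩
  | .memConst i c => ⟨s.idx, Function.update s.mem (s.idx i) (c : ℝ)⟩
  | .memCopy i j => ⟨s.idx, Function.update s.mem (s.idx i) (s.mem (s.idx j))⟩
  | .memArith op i j l =>
    ⟨s.idx, Function.update s.mem (s.idx i) (op.eval (s.mem (s.idx j)) (s.mem (s.idx l)))⟩

/-- The tests `I[i] < I[j]` and `M[I[i]] ≤ M[I[j]]`. -/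
inductive Test where
  | idxLt (i j : ℕ)
  | memLe (i j : ℕ)

def Test.Holds (s : State) : Test → Prop
  | .idxLt i j => s.idx i < s.idx j
  | .memLe i j => s.mem (s.idx i) ≤ s.mem (s.idx j)

/-- Programs are finite; the same program serves inputs of all sizes. -/
inductive Program where
  | instr (i : Instr)
  | seq (P R : Program)
  | ite (b : Test) (P R : Program)
  | while (b : Test) (P : Program)

/-- `Exec P s t s'`: the program `P`, started in the state `s`, halts in the state `s'` after
exactly `t` operations. Each instruction (arithmetic or index) and each test is one operation. -/
inductive Exec : Program → State → ℕ → State → Prop where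
  | instr {i : Instr} {s : State} (h : i.Defined s) : Exec (.instr i) s 1 (i.run s)
  | seq {P R : Program} {s s' s'' : State} {t t' : ℕ}
      (hP : Exec P s t s') (hR : Exec R s' t' s'') : Exec (.seq P R) s (t + t') s''
  | iteTrue {b : Test} {P R : Program} {s s' : State} {t : ℕ}
      (hb : b.Holds s) (hP : Exec P s t s') : Exec (.ite b P R) s (t + 1) s'
  | iteFalse {b : Test} {P R : Program} {s s' : State} {t : ℕ}
      (hb : ¬ b.Holds s) (hR : Exec R s t s') : Exec (.ite b P R) s (t + 1) s'
  | whileFalse {b : Test} {P : Program} {s : State}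
      (hb : ¬ b.Holds s) : Exec (.while b P) s 1 s
  | whileTrue {b : Test} {P : Program} {s s' s'' : State} {t t' : ℕ}
      (hb : b.Holds s) (hP : Exec P s t s') (hW : Exec (.while b P) s' t' s'') :
      Exec (.while b P) s (t + t' + 1) s''

/-- The input: `I[0] = k`, `M[0] = n`, `M[d] = Ω_d` for `1 ≤ d ≤ k`, and zero elsewhere. -/
def inputState (k : ℕ) (n : ℝ) (Ω : ℕ → ℝ) : State where
  idx i := if i = 0 then k else 0
  mem a := if a = 0 then n else if a ≤ k then Ω a else 0

end RealRAM

end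

/-!
Let `u` symbols be undecoded, let `A` be the decoded set and `R` the ripple. The event that the
decoder arrives at `(A, R)` depends only on the received neighbourhoods with at most one element
outside `A` (`decoded_eq_of_agree`). When `a ∈ R` is decoded, a symbol `b` outside `A ∪ R` joins the
ripple iff a neighbourhood `S` with `S \ A = {a, b}` is received. These families are disjoint for
different `b` and disjoint from the conditioning event, so that each of the `u - X_u` symbols `b`
joins independently with probability `q_u`. This is `graphMean_transition`:
`E[x ^ X_{u-1} y ^ (u-1-X_{u-1}); X_u ≥ 1]` equals
`E[x ^ (X_u-1) (q_u x + (1-q_u) y) ^ (u-X_u); X_u ≥ 1]`.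

With `y = 1` the identity gives the recursion of the generating polynomials. With `x = 1` it gives a
recursion that needs no polynomial arithmetic: the substitution `y ↦ q_u + (1 - q_u) y` is the
scaling by `1 - q_u` in the variable `y - 1`, so the binomial moments
`E[binom(u - X_u, j); X_u ≥ 1]` are multiplied by `(1 - q_u) ^ j`, and the part that belongs to the
event `X_{u-1} = 0` is known from the moment with `j = u - 1` (`outsideMoment_step`). One step costs
`O(k)` operations, hence `O(k ^ 2)` in all; the zeroth moment for `u = 1` is the success probability
(`momentRow_eq_success`).

The probabilities `q_u` come from a multiplicative difference scheme: the rows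
`T 0 d = 1 - p_d`, `T (m + 1) d = T m d * T m (d + 1)` satisfy `1 - q_u = T (k - u) 2` by Pascal's
rule (`avoidTable_eq`, `one_sub_avoidTable`), and only the entries with `d ≤ D` differ from `1`. So
`O(D k)` multiplications are enough.

The programs are verified with invariants for their loops (`Runs.while`), which count the operations
at the same time.
-/

namespace LTCode

/-! ### Random subsets with independent elements -/

section RandomSubset

variable {α : Type*} [Fintype α] [DecidableEq α]

/-- The probability of `G` when every `a` belongs to the random subset `G` with probability `p a`,
independently of the others. -/
noncomputable def subsetWeight (p : α → ℝ) (G : Finset α) : ℝ :=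
  ∏ a, if a ∈ G then p a else 1 - p a

/-- The expectation of `f G` for the random subset `G` of `subsetWeight`. -/
noncomputable def subsetMean (p : α → ℝ) (f : Finset α → ℝ) : ℝ :=
  ∑ G, subsetWeight p G * f G

/-- `f G` depends only on which elements of `F` belong to `G`. -/
def DependsOnlyOn (f : Finset α → ℝ) (F : Finset α) : Prop :=
  ∀ G G' : Finset α, (∀ a ∈ F, a ∈ G ↔ a ∈ G') → f G = f G'

omit [Fintype α] [DecidableEq α] in
theorem DependsOnlyOn.mono {f : Finset α → ℝ} {F F' : Finset α} (hf : DependsOnlyOn f F)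
    (h : F ⊆ F') : DependsOnlyOn f F' :=
  fun G G' hG => hf G G' fun a ha => hG a (h ha)

omit [Fintype α] [DecidableEq α] in
theorem DependsOnlyOn.mul {f g : Finset α → ℝ} {F : Finset α} (hf : DependsOnlyOn f F)
    (hg : DependsOnlyOn g F) : DependsOnlyOn (fun G => f G * g G) F :=
  fun G G' hG => by simp only [hf G G' hG, hg G G' hG]

theorem subsetMean_add (p : α → ℝ) (f g : Finset α → ℝ) :
    subsetMean p (fun G => f G + g G) = subsetMean p f + subsetMean p g := by
  simp only [subsetMean, mul_add, sum_add_distrib]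

theorem subsetMean_sub (p : α → ℝ) (f g : Finset α → ℝ) :
    subsetMean p (fun G => f G - g G) = subsetMean p f - subsetMean p g := by
  simp only [subsetMean, mul_sub, sum_sub_distrib]

theorem subsetMean_mul_const (p : α → ℝ) (f : Finset α → ℝ) (c : ℝ) :
    subsetMean p (fun G => f G * c) = subsetMean p f * c := by
  simp only [subsetMean, ← mul_assoc, sum_mul]

theorem subsetMean_sum {ι : Type*} (p : α → ℝ) (s : Finset ι) (f : ι → Finset α → ℝ) :
    subsetMean p (fun G => ∑ i ∈ s, f i G) = ∑ i ∈ s, subsetMean p (f i) := by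
  simp only [subsetMean, mul_sum]
  exact sum_comm

/-- The expectation of a product over all elements, one factor per element. -/
theorem subsetMean_prod_ite (p z y : α → ℝ) :
    subsetMean p (fun G => ∏ a, if a ∈ G then z a else y a) =
      ∏ a, (p a * z a + (1 - p a) * y a) := by
  rw [Fintype.prod_add]
  refine sum_congr rfl fun G _ => ?_
  rw [subsetWeight, ← prod_mul_distrib, ← prod_mul_prod_compl G]
  congr 1
  · exact prod_congr rfl fun a ha => by simp [ha]
  · exact prod_congr rfl fun a ha => by simp [mem_compl.mp ha]

theorem subsetMean_one (p : α → ℝ) : subsetMean p (fun _ => 1) = 1 := by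
  simpa using subsetMean_prod_ite p (fun _ => 1) (fun _ => 1)

theorem sum_eq_sum_powerset_union (F : Finset α) (h : Finset α → ℝ) :
    ∑ G, h G = ∑ A ∈ F.powerset, ∑ B ∈ Fᶜ.powerset, h (A ∪ B) := by
  rw [← sum_product']
  refine sum_nbij' (fun G => (G ∩ F, G ∩ Fᶜ)) (fun P => P.1 ∪ P.2) ?_ ?_ ?_ ?_ ?_
  · intro G _
    simp only [mem_product, mem_powerset]
    exact ⟨inter_subset_right, inter_subset_right⟩
  · simp
  · intro G _
    rw [← inter_union_distrib_left, union_compl, inter_univ]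
  · rintro ⟨A, B⟩ hAB
    simp only [mem_product, mem_powerset] at hAB
    have h1 : ∀ x ∈ B, x ∉ F := fun x hx => mem_compl.mp (hAB.2 hx)
    have h2 : ∀ x ∈ A, x ∈ F := fun x hx => hAB.1 hx
    ext x
    · simp only [mem_inter, mem_union]
      grind
    · simp only [mem_inter, mem_union, mem_compl]
      grind
  · intro G _
    rw [← inter_union_distrib_left, union_compl, inter_univ]

/-- Functions of disjoint sets of coordinates are independent. -/
theorem subsetMean_mul {p : α → ℝ} {f g : Finset α → ℝ} {F : Finset α}
    (hf : DependsOnlyOn f F) (hg : DependsOnlyOn g Fᶜ) :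
    subsetMean p (fun G => f G * g G) = subsetMean p f * subsetMean p g := by
  -- Every expectation of such a product factors as a sum over the parts in `F` and in `Fᶜ`.
  have key : ∀ f g : Finset α → ℝ, DependsOnlyOn f F → DependsOnlyOn g Fᶜ →
      subsetMean p (fun G => f G * g G) =
        (∑ A ∈ F.powerset, (∏ a ∈ F, if a ∈ A then p a else 1 - p a) * f A) *
        ∑ B ∈ Fᶜ.powerset, (∏ a ∈ Fᶜ, if a ∈ B then p a else 1 - p a) * g B := by
    intro f g hf hg
    rw [subsetMean, sum_eq_sum_powerset_union F, sum_mul_sum]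
    refine sum_congr rfl fun A hA => sum_congr rfl fun B hB => ?_
    rw [mem_powerset] at hA hB
    have hB' : ∀ a ∈ F, a ∉ B := fun a ha hb => mem_compl.mp (hB hb) ha
    have hA' : ∀ a ∈ Fᶜ, a ∉ A := fun a ha hb => mem_compl.mp ha (hA hb)
    rw [hf (A ∪ B) A fun a ha => by simp [hB' a ha],
      hg (A ∪ B) B fun a ha => by simp [hA' a ha], subsetWeight, ← prod_mul_prod_compl F]
    have e1 : ∏ a ∈ F, (if a ∈ A ∪ B then p a else 1 - p a) =
        ∏ a ∈ F, if a ∈ A then p a else 1 - p a :=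
      prod_congr rfl fun a ha => by simp [hB' a ha]
    have e2 : ∏ a ∈ Fᶜ, (if a ∈ A ∪ B then p a else 1 - p a) =
        ∏ a ∈ Fᶜ, if a ∈ B then p a else 1 - p a :=
      prod_congr rfl fun a ha => by simp only [mem_union, hA' a ha, false_or]
    rw [e1, e2]
    ring
  have one : ∀ F : Finset α, DependsOnlyOn (fun _ => 1) F := fun _ _ _ _ => rfl
  have h1 := key _ _ (one F) (one Fᶜ)
  have h2 := key _ _ hf (one Fᶜ)
  have h3 := key _ _ (one F) hg
  simp only [one_mul, mul_one] at h1 h2 h3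
  rw [subsetMean_one] at h1
  rw [key f g hf hg, h2, h3]
  linear_combination ((∑ A ∈ F.powerset, (∏ a ∈ F, if a ∈ A then p a else 1 - p a) * f A) *
    ∑ B ∈ Fᶜ.powerset, (∏ a ∈ Fᶜ, if a ∈ B then p a else 1 - p a) * g B) * h1

/-- Functions of pairwise disjoint sets of coordinates are independent. -/
theorem subsetMean_mul_prod {ι : Type*} {p : α → ℝ} {f : Finset α → ℝ}
    {F : Finset α} (hf : DependsOnlyOn f F) (s : Finset ι) {g : ι → Finset α → ℝ}
    {T : ι → Finset α} (hg : ∀ i ∈ s, DependsOnlyOn (g i) (T i))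
    (hF : ∀ i ∈ s, Disjoint F (T i))
    (hT : ∀ i ∈ s, ∀ j ∈ s, i ≠ j → Disjoint (T i) (T j)) :
    subsetMean p (fun G => f G * ∏ i ∈ s, g i G) =
      subsetMean p f * ∏ i ∈ s, subsetMean p (g i) := by
  classical
  induction s using Finset.induction_on generalizing f F with
  | empty => simp
  | insert i s hi ih =>
    have hfi : DependsOnlyOn (fun G => f G * g i G) (F ∪ T i) :=
      (hf.mono subset_union_left).mul ((hg i (mem_insert_self i s)).mono subset_union_right)
    have h := ih hfi (fun j hj => hg j (mem_insert_of_mem hj))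
      (fun j hj => by
        rw [disjoint_union_left]
        exact ⟨hF j (mem_insert_of_mem hj), hT i (mem_insert_self i s) j (mem_insert_of_mem hj)
          fun e => hi (e ▸ hj)⟩)
      (fun j hj l hl => hT j (mem_insert_of_mem hj) l (mem_insert_of_mem hl))
    have h' : subsetMean p (fun G => f G * g i G) = subsetMean p f * subsetMean p (g i) :=
      subsetMean_mul hf ((hg i (mem_insert_self i s)).mono fun a ha =>
        mem_compl.mpr fun hb => disjoint_left.mp (hF i (mem_insert_self i s)) hb ha)
    simp only [prod_insert hi, ← mul_assoc]
    rw [h, h']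

/-- A two-valued function which tells whether the random set meets `T`. -/
theorem subsetMean_ite_exists (p : α → ℝ) (T : Finset α) (x y : ℝ) :
    subsetMean p (fun G => if ∃ a ∈ T, a ∈ G then x else y) =
      (1 - ∏ a ∈ T, (1 - p a)) * x + (∏ a ∈ T, (1 - p a)) * y := by
  have h0 : subsetMean p (fun G => if ∃ a ∈ T, a ∈ G then 0 else 1) = ∏ a ∈ T, (1 - p a) := by
    have h := subsetMean_prod_ite p (fun a => if a ∈ T then 0 else 1) (fun _ => 1)
    have e1 : ∀ G : Finset α, (∏ a, if a ∈ G then (if a ∈ T then (0 : ℝ) else 1) else 1) =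
        if ∃ a ∈ T, a ∈ G then 0 else 1 := by
      intro G
      split_ifs with hG
      · obtain ⟨a, haT, haG⟩ := hG
        exact prod_eq_zero (mem_univ a) (by simp [haT, haG])
      · push Not at hG
        refine prod_eq_one fun a _ => ?_
        by_cases haT : a ∈ T
        · simp [hG a haT]
        · simp [haT]
    simp only [e1] at h
    rw [h, ← Fintype.prod_ite_mem T]
    exact prod_congr rfl fun a _ => by split_ifs <;> ring
  have h1 : (fun G : Finset α => if ∃ a ∈ T, a ∈ G then x else y) =
      fun G => 1 * x + (if ∃ a ∈ T, a ∈ G then 0 else 1) * (y - x) := by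
    funext G
    split_ifs <;> ring
  rw [h1, subsetMean_add, subsetMean_mul_const, subsetMean_mul_const, subsetMean_one, h0]
  ring

end RandomSubset

/-! ### The dynamics of the decoder -/

section Decoder

variable {k : ℕ} {sel : Finset (Fin k) → Finset (Fin k) → Fin k} {G G' : FactorGraph k}
  {A R : Finset (Fin k)}

theorem mem_ripple {a : Fin k} : a ∈ ripple G A ↔ ∃ S ∈ G, S \ A = {a} := by
  simp [ripple]

theorem notMem_of_mem_ripple {a : Fin k} (h : a ∈ ripple G A) : a ∉ A := by
  obtain ⟨S, -, hS⟩ := mem_ripple.mp h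
  exact (mem_sdiff.mp (hS ▸ mem_singleton_self a)).2

theorem ripple_subset_compl : ripple G A ⊆ Aᶜ :=
  fun _ h => mem_compl.mpr (notMem_of_mem_ripple h)

theorem decoded_succ_of_nonempty {t : ℕ} (h : (ripple G (decoded sel G t)).Nonempty) :
    decoded sel G (t + 1) =
      insert (sel (decoded sel G t) (ripple G (decoded sel G t))) (decoded sel G t) := by
  rw [decoded, if_pos h]

theorem decoded_succ_of_empty {t : ℕ} (h : ripple G (decoded sel G t) = ∅) :
    decoded sel G (t + 1) = decoded sel G t := by
  rw [decoded, if_neg (by simp [h])]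

theorem decoded_mono (sel : Finset (Fin k) → Finset (Fin k) → Fin k) (G : FactorGraph k) :
    Monotone (decoded sel G) := by
  refine monotone_nat_of_le_succ fun t => ?_
  rw [decoded]
  split_ifs
  · exact subset_insert _ _
  · exact le_rfl

/-- As long as the ripple is nonempty, one symbol has been decoded in every step. -/
theorem card_decoded (hsel : IsSelectionRule sel) {t : ℕ}
    (h : (ripple G (decoded sel G t)).Nonempty) : #(decoded sel G t) = t := by
  induction t with
  | zero => rfl
  | succ t ih =>
    rcases (ripple G (decoded sel G t)).eq_empty_or_nonempty with h0 | h0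
    · rw [decoded_succ_of_empty h0, h0] at h
      exact absurd h not_nonempty_empty
    · rw [decoded_succ_of_nonempty h0,
        card_insert_of_notMem (notMem_of_mem_ripple (hsel _ _ h0)), ih h0]

theorem card_decoded_succ (hsel : IsSelectionRule sel) {t : ℕ}
    (h : (ripple G (decoded sel G t)).Nonempty) : #(decoded sel G (t + 1)) = t + 1 := by
  rw [decoded_succ_of_nonempty h,
    card_insert_of_notMem (notMem_of_mem_ripple (hsel _ _ h)), card_decoded hsel h]

theorem rippleSize_le (hsel : IsSelectionRule sel) (G : FactorGraph k) {u : ℕ} (hu : u ≤ k) :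
    rippleSize sel G u ≤ u := by
  rw [rippleSize]
  rcases (ripple G (decoded sel G (k - u))).eq_empty_or_nonempty with h0 | h0
  · simp [h0]
  · refine (card_le_card ripple_subset_compl).trans ?_
    rw [card_compl, Fintype.card_fin, card_decoded hsel h0]
    omega

/-- A decoder which has stopped stays stopped. -/
theorem rippleSize_pred_eq_zero {u : ℕ} (h1 : 1 ≤ u) (hu : u ≤ k)
    (h : rippleSize sel G u = 0) : rippleSize sel G (u - 1) = 0 := by
  rw [rippleSize, card_eq_zero] at *
  rw [show k - (u - 1) = k - u + 1 by omega, decoded_succ_of_empty h, h]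

/-- All symbols are recovered iff the ripple is nonempty when one symbol is undecoded. -/
theorem decoded_ne_univ_iff (hsel : IsSelectionRule sel) (G : FactorGraph k) (hk : 1 ≤ k) :
    decoded sel G k ≠ univ ↔ rippleSize sel G 1 = 0 := by
  obtain ⟨t, rfl⟩ : ∃ t, k = t + 1 := ⟨k - 1, by omega⟩
  rw [rippleSize, card_eq_zero, Nat.add_sub_cancel]
  rcases (ripple G (decoded sel G t)).eq_empty_or_nonempty with h0 | h0
  · refine iff_of_true (fun h => ?_) h0
    -- At most `t` symbols are decoded in `t` steps, and the last step decodes none.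
    have key : ∀ s, #(decoded sel G s) ≤ s := by
      intro s
      induction s with
      | zero => simp [decoded]
      | succ s ih =>
        rcases (ripple G (decoded sel G s)).eq_empty_or_nonempty with h0 | h0
        · rw [decoded_succ_of_empty h0]; omega
        · rw [card_decoded_succ hsel h0]
    have h2 := key t
    rw [← decoded_succ_of_empty h0, h, card_univ, Fintype.card_fin] at h2
    omega
  · refine iff_of_false (fun h => h ?_) h0.ne_empty
    rw [← card_eq_iff_eq_univ, card_decoded_succ hsel h0, Fintype.card_fin]

/-- The ripple after the symbol `a` is decoded. -/
theorem mem_ripple_insert {a b : Fin k} (ha : a ∉ A) :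
    b ∈ ripple G (insert a A) ↔
      b ∈ (insert a A)ᶜ ∧ (b ∈ ripple G A ∨ ∃ S ∈ G, S \ A = {a, b}) := by
  constructor
  · intro h
    refine ⟨ripple_subset_compl h, ?_⟩
    obtain ⟨S, hS, hb⟩ := mem_ripple.mp h
    by_cases haS : a ∈ S
    · refine Or.inr ⟨S, hS, ?_⟩
      ext x
      have hx := Finset.ext_iff.mp hb x
      simp only [mem_sdiff, mem_insert, mem_singleton] at hx ⊢
      grind
    · refine Or.inl (mem_ripple.mpr ⟨S, hS, ?_⟩)
      ext x
      have hx := Finset.ext_iff.mp hb x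
      simp only [mem_sdiff, mem_insert, mem_singleton] at hx ⊢
      grind
  · rintro ⟨hb, h | ⟨S, hS, h⟩⟩
    · obtain ⟨S, hS, h⟩ := mem_ripple.mp h
      refine mem_ripple.mpr ⟨S, hS, ?_⟩
      ext x
      have hx := Finset.ext_iff.mp h x
      simp only [mem_sdiff, mem_insert, mem_singleton, mem_compl] at hx hb ⊢
      grind
    · refine mem_ripple.mpr ⟨S, hS, ?_⟩
      ext x
      have hx := Finset.ext_iff.mp h x
      simp only [mem_sdiff, mem_insert, mem_singleton, mem_compl] at hx hb ⊢
      grind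

/-- The course of the decoder up to the decoded set `A` does not depend on the neighbourhoods
that have two or more elements outside `A`. -/
theorem decoded_eq_of_agree {t : ℕ} (hA : decoded sel G t = A)
    (h : ∀ S, #(S \ A) ≤ 1 → (S ∈ G ↔ S ∈ G')) :
    decoded sel G' t = A ∧ ripple G' A = ripple G A := by
  have hr : ∀ B ⊆ A, ripple G' B = ripple G B := by
    intro B hB
    ext a
    have hS : ∀ S, S \ B = {a} → (S ∈ G ↔ S ∈ G') := fun S hS =>
      h S ((card_le_card (sdiff_subset_sdiff le_rfl hB)).trans (by rw [hS, card_singleton]))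
    simp only [mem_ripple]
    exact exists_congr fun S => and_congr_left fun e => (hS S e).symm
  have hs : ∀ s ≤ t, decoded sel G' s = decoded sel G s := by
    intro s
    induction s with
    | zero => intro _; rfl
    | succ s ih =>
      intro hst
      have e := ih (by omega)
      have hB : decoded sel G s ⊆ A := hA ▸ decoded_mono sel G (by omega : s ≤ t)
      simp only [decoded, e, hr _ hB]
  exact ⟨(hs t le_rfl).trans hA, hr A Subset.rfl⟩

end Decoder

/-! ### The probabilities `q_u` -/

theorem recvProb_eq_zero {k : ℕ} {n : ℝ} {Ω : ℕ → ℝ} (hM : IsPoissonModel k n Ω) {d : ℕ}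
    (hd : maxDegree k Ω < d) : recvProb k n Ω d = 0 := by
  have h0 : Ω d = 0 := by
    by_contra hne
    have hmem : d ∈ Icc 1 k := by
      by_contra hnot
      exact hne (hM.support d hnot)
    have hle : id d ≤ maxDegree k Ω :=
      le_sup (f := id) (mem_filter.mpr ⟨hmem, lt_of_le_of_ne (hM.nonneg d) (Ne.symm hne)⟩)
    exact absurd hle (by simpa using hd)
  simp [recvProb, h0]

theorem joinProb_eq {k : ℕ} {n : ℝ} {Ω : ℕ → ℝ} (hM : IsPoissonModel k n Ω) (u : ℕ) :
    joinProb k n Ω u =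
      1 - ∏ j ∈ range (k - u + 1), (1 - recvProb k n Ω (j + 2)) ^ (k - u).choose j := by
  have h1 : ∏ d ∈ Icc 2 (min (maxDegree k Ω) (k - u + 2)),
      (1 - recvProb k n Ω d) ^ (k - u).choose (d - 2) =
      ∏ d ∈ Icc 2 (k - u + 2), (1 - recvProb k n Ω d) ^ (k - u).choose (d - 2) := by
    refine prod_subset (Icc_subset_Icc_right (min_le_right _ _)) fun d hd hd' => ?_
    rw [recvProb_eq_zero hM, sub_zero, one_pow]
    simp only [mem_Icc, le_min_iff] at hd hd'
    omega
  have h2 : Icc 2 (k - u + 2) = Ico (0 + 2) (k - u + 1 + 2) := by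
    ext d
    simp only [mem_Icc, mem_Ico]
    omega
  rw [joinProb, h1, h2, ← prod_Ico_add', range_eq_Ico]
  rfl

/-- The probability that no received neighbourhood has exactly the elements `a`, `b` outside the
set `A` of decoded symbols. -/
theorem prod_one_sub_recvProb_pair {k : ℕ} {n : ℝ} {Ω : ℕ → ℝ} (hM : IsPoissonModel k n Ω)
    {u : ℕ} {A : Finset (Fin k)} (hA : #A = k - u) {a b : Fin k} (ha : a ∉ A) (hb : b ∉ A)
    (hab : a ≠ b) :
    ∏ S ∈ univ.filter (fun S : Finset (Fin k) => S \ A = {a, b}), (1 - recvProb k n Ω #S) =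
      1 - joinProb k n Ω u := by
  have h1 : ∏ S ∈ univ.filter (fun S : Finset (Fin k) => S \ A = {a, b}),
      (1 - recvProb k n Ω #S) = ∏ S ∈ A.powerset, (1 - recvProb k n Ω (#S + 2)) := by
    have hd : Disjoint A {a, b} := by
      rw [disjoint_right]
      simp [ha, hb]
    refine prod_nbij' (fun S => S ∩ A) (fun S => S ∪ {a, b}) ?_ ?_ ?_ ?_ ?_
    · intro S _
      exact mem_powerset.mpr inter_subset_right
    · intro S hS
      have hS' := mem_powerset.mp hS
      simp only [mem_filter, mem_univ, true_and]
      rw [union_sdiff_distrib, sdiff_eq_empty_iff_subset.mpr hS', empty_union,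
        sdiff_eq_self_of_disjoint hd.symm]
    · intro S hS
      rw [mem_filter] at hS
      rw [← hS.2, union_comm, sdiff_union_inter]
    · intro S hS
      have hS' := mem_powerset.mp hS
      rw [union_inter_distrib_right, disjoint_iff_inter_eq_empty.mp hd.symm, union_empty,
        inter_eq_left.mpr hS']
    · intro S hS
      rw [mem_filter] at hS
      rw [← card_inter_add_card_sdiff S A, hS.2, card_pair hab]
  rw [h1, prod_powerset, joinProb_eq hM, hA, sub_sub_cancel]
  refine prod_congr rfl fun j _ => ?_
  rw [prod_congr rfl (g := fun _ => 1 - recvProb k n Ω (j + 2)), prod_const, card_powersetCard, hA]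
  intro S hS
  rw [(mem_powersetCard.mp hS).2]

/-! ### The transition of the ripple size -/

/-- The expectation of `f G` for the random factor graph `G`. -/
noncomputable def graphMean (k : ℕ) (n : ℝ) (Ω : ℕ → ℝ) (f : FactorGraph k → ℝ) : ℝ :=
  subsetMean (fun S : Finset (Fin k) => recvProb k n Ω #S) f

theorem prob_eq_graphMean (k : ℕ) (n : ℝ) (Ω : ℕ → ℝ) (E : FactorGraph k → Prop)
    [DecidablePred E] : prob k n Ω E = graphMean k n Ω fun G => if E G then 1 else 0 := by
  simp only [prob, graphMean, subsetMean, mul_ite, mul_one, mul_zero, sum_filter]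
  rfl

theorem prod_ite_mem_eq_pow {ι : Type*} [DecidableEq ι] {N B : Finset ι} (h : N ⊆ B) (x y : ℝ) :
    ∏ b ∈ B, (if b ∈ N then x else y) = x ^ #N * y ^ (#B - #N) := by
  rw [prod_ite, prod_const, prod_const, filter_mem_eq_inter, inter_eq_right.mpr h,
    filter_notMem_eq_sdiff, card_sdiff_of_subset h]

/-- The expectation over a cylinder event: given that the decoded set is `A` and the ripple is `R`,
each of the other undecoded symbols joins the ripple independently with probability `q_u`. -/
theorem graphMean_transition_of_eq {k : ℕ} {n : ℝ} {Ω : ℕ → ℝ}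
    {sel : Finset (Fin k) → Finset (Fin k) → Fin k} (hM : IsPoissonModel k n Ω)
    (hsel : IsSelectionRule sel) {u : ℕ} (h1 : 1 ≤ u) (hu : u ≤ k) (x y : ℝ)
    (A R : Finset (Fin k)) :
    graphMean k n Ω (fun G =>
      (if decoded sel G (k - u) = A ∧ ripple G A = R then 1 else 0) *
        if rippleSize sel G u = 0 then 0 else
          x ^ rippleSize sel G (u - 1) * y ^ (u - 1 - rippleSize sel G (u - 1))) =
    graphMean k n Ω (fun G =>
      (if decoded sel G (k - u) = A ∧ ripple G A = R then 1 else 0) *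
        if rippleSize sel G u = 0 then 0 else
          x ^ (rippleSize sel G u - 1) *
            (joinProb k n Ω u * x + (1 - joinProb k n Ω u) * y) ^ (u - rippleSize sel G u)) := by
  have hX : ∀ G, decoded sel G (k - u) = A ∧ ripple G A = R → rippleSize sel G u = #R := by
    rintro G ⟨hA, hR⟩
    rw [rippleSize, hA, hR]
  by_cases hE : ∃ G, (decoded sel G (k - u) = A ∧ ripple G A = R) ∧ R.Nonempty
  swap
  · congr 1
    funext G
    by_cases hG : decoded sel G (k - u) = A ∧ ripple G A = R
    · have h0 : rippleSize sel G u = 0 := by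
        rw [hX G hG, card_eq_zero]
        exact not_nonempty_iff_eq_empty.mp fun h => hE ⟨G, hG, h⟩
      simp only [h0, if_true]
    · simp only [if_neg hG, zero_mul]
  obtain ⟨G₀, ⟨hA₀, hR₀⟩, hR⟩ := hE
  have hcard : #A = k - u := by
    have h := card_decoded hsel (G := G₀) (t := k - u) (by rwa [hA₀, hR₀])
    rwa [hA₀] at h
  have hRA : R ⊆ Aᶜ := hR₀ ▸ ripple_subset_compl
  set a := sel A R with ha
  have haR : a ∈ R := hsel A R hR
  have haA : a ∉ A := mem_compl.mp (hRA haR)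
  have hRpos : 1 ≤ #R := hR.card_pos
  have hcardc : #Aᶜ = u := by
    rw [card_compl, Fintype.card_fin, hcard]
    omega
  -- An undecoded `b` outside `R` joins the ripple when `a` is decoded iff an element of `T b` is
  -- received.
  let T : Fin k → Finset (Finset (Fin k)) := fun b => univ.filter fun S => S \ A = {a, b}
  have hnext : ∀ G, decoded sel G (k - u) = A ∧ ripple G A = R →
      x ^ rippleSize sel G (u - 1) * y ^ (u - 1 - rippleSize sel G (u - 1)) =
        x ^ (#R - 1) * ∏ b ∈ Aᶜ \ R, if ∃ S ∈ T b, S ∈ G then x else y := by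
    rintro G ⟨hA, hRG⟩
    have hdec : decoded sel G (k - (u - 1)) = insert a A := by
      rw [show k - (u - 1) = k - u + 1 by omega,
        decoded_succ_of_nonempty (by rwa [hA, hRG]), hA, hRG]
    have hB : #(insert a A)ᶜ = u - 1 := by
      rw [card_compl, Fintype.card_fin, card_insert_of_notMem haA, hcard]
      omega
    rw [rippleSize, hdec, ← hB, ← prod_ite_mem_eq_pow ripple_subset_compl]
    have hsplit : (insert a A)ᶜ = R.erase a ∪ (Aᶜ \ R) := by
      ext b
      have := @hRA b
      simp only [mem_compl, mem_insert, mem_union, mem_erase, mem_sdiff] at this ⊢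
      grind
    have hdisj : Disjoint (R.erase a) (Aᶜ \ R) :=
      disjoint_of_subset_left (erase_subset a R) disjoint_sdiff
    have hmem : ∀ b ∈ (insert a A)ᶜ, b ∈ ripple G (insert a A) ↔ (b ∈ R ∨ ∃ S ∈ T b, S ∈ G) := by
      intro b hb
      rw [mem_ripple_insert haA, hRG]
      simp only [hb, true_and, T, mem_filter, mem_univ]
      exact or_congr Iff.rfl (exists_congr fun S => and_comm)
    rw [prod_congr rfl fun b hb => by rw [if_congr (hmem b hb) rfl rfl], hsplit,
      prod_union hdisj]
    congr 1
    · rw [prod_congr rfl (g := fun _ => x) fun b hb => if_pos (Or.inl (mem_of_mem_erase hb)),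
        prod_const, card_erase_of_mem haR]
    · refine prod_congr rfl fun b hb => if_congr ?_ rfl rfl
      simp only [(mem_sdiff.mp hb).2, false_or]
  -- The conditioning event depends on neighbourhoods with at most one element outside `A`, so it is
  -- independent of the families `T b`.
  have hdep : DependsOnlyOn
      (fun G => if decoded sel G (k - u) = A ∧ ripple G A = R then (1 : ℝ) else 0)
      (univ.filter fun S : Finset (Fin k) => #(S \ A) ≤ 1) := by
    intro G G' hGG
    have hag : ∀ S, #(S \ A) ≤ 1 → (S ∈ G ↔ S ∈ G') := fun S hS => hGG S (by simp [hS])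
    refine if_congr ⟨?_, ?_⟩ rfl rfl
    · rintro ⟨hA, hRG⟩
      have h := decoded_eq_of_agree hA hag
      exact ⟨h.1, h.2.trans hRG⟩
    · rintro ⟨hA, hRG⟩
      have h := decoded_eq_of_agree hA fun S hS => (hag S hS).symm
      exact ⟨h.1, h.2.trans hRG⟩
  have hne : ∀ b ∈ Aᶜ \ R, a ≠ b := by
    rintro b hb rfl
    exact (mem_sdiff.mp hb).2 haR
  have hmul := subsetMean_mul_prod (p := fun S : Finset (Fin k) => recvProb k n Ω #S) hdep
    (Aᶜ \ R) (g := fun b G => if ∃ S ∈ T b, S ∈ G then x else y) (T := T)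
    (fun b _ G G' hGG => if_congr
      (exists_congr fun S => and_congr_right fun hS => hGG S hS) rfl rfl)
    (fun b hb => disjoint_left.mpr fun S hS hS' => by
      have h2 := (mem_filter.mp hS).2
      rw [(mem_filter.mp hS').2, card_pair (hne b hb)] at h2
      omega)
    (fun b hb c hc hbc => disjoint_left.mpr fun S hS hS' => by
      have h2 := (mem_filter.mp hS).2.symm.trans (mem_filter.mp hS').2
      have h3 : b ∈ ({a, c} : Finset (Fin k)) := h2 ▸ mem_insert_of_mem (mem_singleton_self b)
      rcases mem_insert.mp h3 with h4 | h4
      · exact hne b hb h4.symm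
      · exact hbc (mem_singleton.mp h4))
  have hfac : ∀ b ∈ Aᶜ \ R, subsetMean (fun S : Finset (Fin k) => recvProb k n Ω #S)
      (fun G => if ∃ S ∈ T b, S ∈ G then x else y) =
      joinProb k n Ω u * x + (1 - joinProb k n Ω u) * y := by
    intro b hb
    rw [subsetMean_ite_exists, prod_one_sub_recvProb_pair hM hcard haA
      (mem_compl.mp (mem_sdiff.mp hb).1) (hne b hb), sub_sub_cancel]
  rw [prod_congr rfl hfac, prod_const, card_sdiff_of_subset hRA, hcardc] at hmul
  have hL : (fun G => (if decoded sel G (k - u) = A ∧ ripple G A = R then (1 : ℝ) else 0) *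
        if rippleSize sel G u = 0 then 0 else
          x ^ rippleSize sel G (u - 1) * y ^ (u - 1 - rippleSize sel G (u - 1))) =
      fun G => ((if decoded sel G (k - u) = A ∧ ripple G A = R then (1 : ℝ) else 0) *
        ∏ b ∈ Aᶜ \ R, if ∃ S ∈ T b, S ∈ G then x else y) * x ^ (#R - 1) := by
    funext G
    by_cases hG : decoded sel G (k - u) = A ∧ ripple G A = R
    · rw [hnext G hG, hX G hG, if_pos hG, if_neg (by omega), one_mul, one_mul, mul_comm]
    · simp only [if_neg hG, zero_mul]
  have hRt : (fun G => (if decoded sel G (k - u) = A ∧ ripple G A = R then (1 : ℝ) else 0) *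
        if rippleSize sel G u = 0 then 0 else
          x ^ (rippleSize sel G u - 1) *
            (joinProb k n Ω u * x + (1 - joinProb k n Ω u) * y) ^ (u - rippleSize sel G u)) =
      fun G => (if decoded sel G (k - u) = A ∧ ripple G A = R then (1 : ℝ) else 0) *
        (x ^ (#R - 1) * (joinProb k n Ω u * x + (1 - joinProb k n Ω u) * y) ^ (u - #R)) := by
    funext G
    by_cases hG : decoded sel G (k - u) = A ∧ ripple G A = R
    · rw [hX G hG, if_pos hG, one_mul, one_mul, if_neg (by omega)]
    · simp only [if_neg hG, zero_mul]
  rw [hL, hRt, graphMean, graphMean, subsetMean_mul_const, subsetMean_mul_const, hmul]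
  ring

/-- The transition from `X_u` to `X_{u-1}`: if `X_u ≥ 1`, one symbol leaves the ripple, and each of
the `u - X_u` other undecoded symbols joins it independently with probability `q_u`. The two
variables mark the undecoded symbols inside and outside the new ripple. -/
theorem graphMean_transition {k : ℕ} {n : ℝ} {Ω : ℕ → ℝ}
    {sel : Finset (Fin k) → Finset (Fin k) → Fin k} (hM : IsPoissonModel k n Ω)
    (hsel : IsSelectionRule sel) {u : ℕ} (h1 : 1 ≤ u) (hu : u ≤ k) (x y : ℝ) :
    graphMean k n Ω (fun G => if rippleSize sel G u = 0 then 0 else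
          x ^ rippleSize sel G (u - 1) * y ^ (u - 1 - rippleSize sel G (u - 1))) =
    graphMean k n Ω (fun G => if rippleSize sel G u = 0 then 0 else
          x ^ (rippleSize sel G u - 1) *
            (joinProb k n Ω u * x + (1 - joinProb k n Ω u) * y) ^ (u - rippleSize sel G u)) := by
  have hsplit : ∀ f : FactorGraph k → ℝ, graphMean k n Ω f = ∑ A, ∑ R, graphMean k n Ω fun G =>
      (if decoded sel G (k - u) = A ∧ ripple G A = R then 1 else 0) * f G := by
    intro f
    simp only [graphMean, ← subsetMean_sum]
    congr 1
    funext G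
    simp [ite_and]
  rw [hsplit, hsplit fun G => if rippleSize sel G u = 0 then 0 else
    x ^ (rippleSize sel G u - 1) * _ ^ (u - rippleSize sel G u)]
  exact sum_congr rfl fun A _ => sum_congr rfl fun R _ =>
    graphMean_transition_of_eq hM hsel h1 hu x y A R

/-- Initially, each symbol is in the ripple independently with probability `p_1`. -/
theorem graphMean_initial {k : ℕ} (n : ℝ) (Ω : ℕ → ℝ)
    (sel : Finset (Fin k) → Finset (Fin k) → Fin k) (x y : ℝ) :
    graphMean k n Ω (fun G => x ^ rippleSize sel G k * y ^ (k - rippleSize sel G k)) =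
      (recvProb k n Ω 1 * x + (1 - recvProb k n Ω 1) * y) ^ k := by
  have hone : DependsOnlyOn (fun _ : FactorGraph k => (1 : ℝ)) ∅ := fun _ _ _ => rfl
  have hmul := subsetMean_mul_prod (p := fun S : Finset (Fin k) => recvProb k n Ω #S) hone univ
    (g := fun b G => if ∃ S ∈ ({{b}} : Finset (Finset (Fin k))), S ∈ G then x else y)
    (T := fun b => {{b}})
    (fun b _ G G' hGG => if_congr
      (exists_congr fun S => and_congr_right fun hS => hGG S hS) rfl rfl)
    (fun b _ => disjoint_empty_left _)
    (fun b _ c _ hbc => by simpa using hbc)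
  simp only [subsetMean_ite_exists, prod_singleton, card_singleton, sub_sub_cancel,
    prod_const, card_univ, Fintype.card_fin, subsetMean_one, one_mul] at hmul
  rw [← hmul, graphMean]
  congr 1
  funext G
  have h := prod_ite_mem_eq_pow (N := ripple G ∅) (subset_univ _) x y
  rw [card_univ, Fintype.card_fin] at h
  rw [rippleSize, Nat.sub_self, decoded, ← h]
  refine prod_congr rfl fun b _ => if_congr ?_ rfl rfl
  simp [mem_ripple]

/-! ### The generating polynomials -/

section GenPoly

variable {k : ℕ} {n : ℝ} {Ω : ℕ → ℝ} {sel : Finset (Fin k) → Finset (Fin k) → Fin k}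

theorem genPoly_eval (hsel : IsSelectionRule sel) {u : ℕ} (hu : u ≤ k) (x : ℝ) :
    (genPoly k n Ω sel u).eval x =
      graphMean k n Ω fun G =>
        if rippleSize sel G u = 0 then 0 else x ^ (rippleSize sel G u - 1) := by
  simp only [genPoly, Polynomial.eval_finsetSum, Polynomial.eval_mul, Polynomial.eval_C,
    Polynomial.eval_pow, Polynomial.eval_X, Q, prob_eq_graphMean, graphMean,
    ← subsetMean_mul_const, ← subsetMean_sum]
  congr 1
  funext G
  have h := rippleSize_le hsel G hu
  simp only [ite_mul, one_mul, zero_mul, sum_ite_eq, mem_Icc]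
  by_cases h0 : rippleSize sel G u = 0
  · simp [h0]
  · rw [if_pos ⟨by omega, h⟩, if_neg h0]

theorem genPoly_initial (hsel : IsSelectionRule sel) {x : ℝ} (hx : x ≠ 0) :
    (genPoly k n Ω sel k).eval x =
      1 / x * ((recvProb k n Ω 1 * x + (1 - recvProb k n Ω 1)) ^ k
        - (1 - recvProb k n Ω 1) ^ k) := by
  have h := graphMean_initial n Ω sel x 1
  have h0 := graphMean_initial n Ω sel 0 1
  rw [mul_one] at h
  rw [mul_zero, mul_one, zero_add] at h0
  rw [genPoly_eval hsel le_rfl, ← h, ← h0]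
  simp only [graphMean, ← subsetMean_sub]
  rw [mul_comm, ← subsetMean_mul_const]
  congr 1
  funext G
  split_ifs with hr
  · simp [hr]
  · obtain ⟨r, hr'⟩ := Nat.exists_eq_succ_of_ne_zero hr
    simp only [hr', Nat.succ_eq_add_one, Nat.add_sub_cancel, one_pow, mul_one, pow_succ, mul_zero]
    field_simp
    ring

theorem genPoly_step (hM : IsPoissonModel k n Ω) (hsel : IsSelectionRule sel) {u : ℕ}
    (h1 : 1 ≤ u) (hu : u ≤ k) {x : ℝ} (hx : x ≠ 0)
    (hq : joinProb k n Ω u * x + (1 - joinProb k n Ω u) ≠ 0) :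
    (genPoly k n Ω sel (u - 1)).eval x =
      (joinProb k n Ω u * x + (1 - joinProb k n Ω u)) ^ (u - 1) / x
        * (genPoly k n Ω sel u).eval (x / (joinProb k n Ω u * x + (1 - joinProb k n Ω u)))
      - (1 - joinProb k n Ω u) ^ (u - 1) / x * (genPoly k n Ω sel u).eval 0 := by
  have h := graphMean_transition hM hsel h1 hu x 1
  have h0 := graphMean_transition hM hsel h1 hu 0 1
  simp only [mul_one, mul_zero, zero_add, one_pow] at h h0
  set q := joinProb k n Ω u
  rw [genPoly_eval hsel (by omega), genPoly_eval hsel hu, genPoly_eval hsel hu]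
  have e1 : (q * x + (1 - q)) ^ (u - 1) / x * graphMean k n Ω (fun G =>
      if rippleSize sel G u = 0 then 0 else (x / (q * x + (1 - q))) ^ (rippleSize sel G u - 1)) =
      graphMean k n Ω (fun G => if rippleSize sel G u = 0 then 0 else
        x ^ rippleSize sel G (u - 1)) * (1 / x) := by
    rw [h, mul_comm, graphMean, graphMean, ← subsetMean_mul_const, ← subsetMean_mul_const]
    congr 1
    funext G
    split_ifs with hr
    · simp
    · have hle := rippleSize_le hsel G hu
      rw [show u - 1 = (u - rippleSize sel G u) + (rippleSize sel G u - 1) by omega, pow_add,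
        div_pow]
      field_simp
  have e2 : (1 - q) ^ (u - 1) / x * graphMean k n Ω (fun G =>
      if rippleSize sel G u = 0 then 0 else (0 : ℝ) ^ (rippleSize sel G u - 1)) =
      graphMean k n Ω (fun G => if rippleSize sel G u = 0 then 0 else
        (0 : ℝ) ^ rippleSize sel G (u - 1)) * (1 / x) := by
    rw [h0, mul_comm, graphMean, graphMean, ← subsetMean_mul_const, ← subsetMean_mul_const]
    congr 1
    funext G
    split_ifs with hr
    · simp
    · by_cases hr1 : rippleSize sel G u = 1
      · rw [hr1, Nat.sub_self, pow_zero]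
        ring
      · rw [zero_pow (by omega)]
        simp
  rw [e1, e2, ← sub_mul]
  simp only [graphMean, ← subsetMean_sub, ← subsetMean_mul_const]
  congr 1
  funext G
  by_cases hr : rippleSize sel G u = 0
  · simp [hr, rippleSize_pred_eq_zero h1 hu hr]
  · simp only [if_neg hr]
    split_ifs with hr'
    · simp [hr']
    · rw [zero_pow hr', sub_zero, mul_one_div, eq_div_iff hx, ← pow_succ,
        Nat.sub_add_cancel (by omega)]

theorem errorProb_eq (hsel : IsSelectionRule sel) (hk : 1 ≤ k) :
    errorProb k n Ω sel = Q k n Ω sel 1 0 := by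
  simp only [errorProb, Q, prob_eq_graphMean, decoded_ne_univ_iff hsel _ hk]

/-- The decoder succeeds iff the ripple is nonempty when one symbol is undecoded. -/
theorem graphMean_success (hsel : IsSelectionRule sel) (hk : 1 ≤ k) :
    graphMean k n Ω (fun G => if rippleSize sel G 1 = 0 then 0 else 1) =
      1 - errorProb k n Ω sel := by
  rw [errorProb_eq hsel hk, Q, prob_eq_graphMean, eq_sub_iff_add_eq, graphMean, graphMean,
    ← subsetMean_add]
  refine Eq.trans ?_ (subsetMean_one fun S : Finset (Fin k) => recvProb k n Ω #S)
  congr 1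
  funext G
  split_ifs <;> simp

theorem genPoly_one (hsel : IsSelectionRule sel) (hk : 1 ≤ k) :
    genPoly k n Ω sel 1 = Polynomial.C (1 - errorProb k n Ω sel) := by
  have h := genPoly_eval (n := n) (Ω := Ω) hsel hk 1
  simp only [one_pow] at h
  rw [graphMean_success hsel hk] at h
  rw [← h]
  simp [genPoly]

end GenPoly

/-! ### Binomial moments of the number of symbols outside the ripple -/

/-- Comparison of the coefficients of `z ^ j`. -/
theorem sum_choose_eq_of_forall_sum_pow_eq {ι : Type*} (s : Finset ι) (a b : ι → ℝ) (N M : ι → ℕ)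
    (c : ℝ) (h : ∀ z : ℝ, ∑ i ∈ s, a i * (1 + z) ^ N i = ∑ i ∈ s, b i * (1 + c * z) ^ M i) (j : ℕ) :
    ∑ i ∈ s, a i * (N i).choose j = (∑ i ∈ s, b i * (M i).choose j) * c ^ j := by
  have hpoly : ∑ i ∈ s, Polynomial.C (a i) * (1 + Polynomial.X) ^ N i =
      ∑ i ∈ s, Polynomial.C (b i) *
        ((1 + Polynomial.X) ^ M i).comp (Polynomial.C c * Polynomial.X) := by
    refine Polynomial.funext fun z => ?_
    simpa [Polynomial.eval_finsetSum] using h z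
  have hj := congrArg (fun p => Polynomial.coeff p j) hpoly
  simp only [Polynomial.finsetSum_coeff, Polynomial.coeff_C_mul, Polynomial.comp_C_mul_X_coeff,
    Polynomial.coeff_one_add_X_pow] at hj
  rw [hj, sum_mul]
  exact sum_congr rfl fun i _ => by ring

/-- The `j`-th binomial moment of the number `u - X_u` of undecoded symbols outside the ripple, on
the event that the decoder has not stopped. -/
noncomputable def outsideMoment (k : ℕ) (n : ℝ) (Ω : ℕ → ℝ)
    (sel : Finset (Fin k) → Finset (Fin k) → Fin k) (u j : ℕ) : ℝ :=
  graphMean k n Ω fun G =>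
    if rippleSize sel G u = 0 then 0 else ((u - rippleSize sel G u).choose j : ℝ)

/-- The probability that an undecoded symbol outside the ripple joins the ripple in the step to
`u - 1` undecoded symbols; `u = k + 1` stands for the formation of the initial ripple. -/
noncomputable def stepProb (k : ℕ) (n : ℝ) (Ω : ℕ → ℝ) (u : ℕ) : ℝ :=
  if u = k + 1 then recvProb k n Ω 1 else joinProb k n Ω u

/-- The moments computed from the join probabilities `q`: the row `i` belongs to `k + 1 - i`
undecoded symbols. Each step scales the `j`-th moment and then subtracts the part that belongs to
the event that the ripple becomes empty. -/
noncomputable def momentRow (k : ℕ) (q : ℕ → ℝ) : ℕ → ℕ → ℝ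
  | 0, j => k.choose j
  | i + 1, j => momentRow k q i j * (1 - q (k - i + 1)) ^ j -
      (k - i).choose j * (momentRow k q i (k - i) * (1 - q (k - i + 1)) ^ (k - i))

section Moments

variable {k : ℕ} {n : ℝ} {Ω : ℕ → ℝ} {sel : Finset (Fin k) → Finset (Fin k) → Fin k}

/-- Restriction of binomial moments of `m - X` from an event `E` that contains `X ≠ 0` to the event
`X ≠ 0`: the `m`-th moment on `E` is the probability of `E` and `X = 0`, because `m - X < m`
otherwise. -/
theorem mean_choose_sub_eq {α : Type*} [Fintype α] [DecidableEq α] (p : α → ℝ) (X : Finset α → ℕ)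
    {E : Finset α → Prop} [DecidablePred E] {m : ℕ} (hm : 1 ≤ m)
    (h0 : ∀ G, X G ≠ 0 → E G) {B : ℕ → ℝ}
    (hB : ∀ j, subsetMean p (fun G => if E G then ((m - X G).choose j : ℝ) else 0) = B j) (j : ℕ) :
    subsetMean p (fun G => if X G = 0 then 0 else ((m - X G).choose j : ℝ)) =
      B j - m.choose j * B m := by
  rw [← hB, ← hB, mul_comm, ← subsetMean_mul_const, ← subsetMean_sub]
  congr 1
  funext G
  by_cases hX : X G = 0
  · by_cases hE : E G <;> simp [hX, hE]
  · rw [if_neg hX, if_pos (h0 G hX), if_pos (h0 G hX),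
      Nat.choose_eq_zero_of_lt (by omega : m - X G < m)]
    simp

theorem outsideMoment_initial (hk : 1 ≤ k) (j : ℕ) :
    outsideMoment k n Ω sel k j =
      k.choose j * (1 - recvProb k n Ω 1) ^ j -
        k.choose j * (k.choose k * (1 - recvProb k n Ω 1) ^ k) := by
  refine mean_choose_sub_eq _ (fun G => rippleSize sel G k) (E := fun _ => True)
    (B := fun j => k.choose j * (1 - recvProb k n Ω 1) ^ j) hk (fun _ _ => trivial) (fun j => ?_) j
  have h := sum_choose_eq_of_forall_sum_pow_eq univ
    (subsetWeight fun S : Finset (Fin k) => recvProb k n Ω #S)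
    (subsetWeight fun S : Finset (Fin k) => recvProb k n Ω #S)
    (fun G => k - rippleSize sel G k) (fun _ => k) (1 - recvProb k n Ω 1) (fun z => ?_) j
  · simp only [← sum_mul] at h
    have h1 := subsetMean_one fun S : Finset (Fin k) => recvProb k n Ω #S
    simp only [subsetMean, mul_one] at h1
    rw [h1, one_mul] at h
    simpa [subsetMean] using h
  · have h := graphMean_initial n Ω sel 1 (1 + z)
    have h1 := subsetMean_one fun S : Finset (Fin k) => recvProb k n Ω #S
    simp only [subsetMean, mul_one] at h1
    rw [← sum_mul, h1, one_mul]
    simp only [graphMean, subsetMean, one_pow, one_mul] at h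
    rw [h]
    ring

theorem outsideMoment_step (hM : IsPoissonModel k n Ω) (hsel : IsSelectionRule sel) {u : ℕ}
    (h2 : 2 ≤ u) (hu : u ≤ k) (j : ℕ) :
    outsideMoment k n Ω sel (u - 1) j =
      outsideMoment k n Ω sel u j * (1 - joinProb k n Ω u) ^ j -
        (u - 1).choose j *
          (outsideMoment k n Ω sel u (u - 1) * (1 - joinProb k n Ω u) ^ (u - 1)) := by
  refine mean_choose_sub_eq _ (fun G => rippleSize sel G (u - 1))
    (E := fun G => rippleSize sel G u ≠ 0)
    (B := fun j => outsideMoment k n Ω sel u j * (1 - joinProb k n Ω u) ^ j) (by omega)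
    (fun G hG h0 => hG (rippleSize_pred_eq_zero (by omega) hu h0)) (fun j => ?_) j
  have h := sum_choose_eq_of_forall_sum_pow_eq univ
    (fun G => subsetWeight (fun S : Finset (Fin k) => recvProb k n Ω #S) G *
      if rippleSize sel G u = 0 then 0 else 1)
    (fun G => subsetWeight (fun S : Finset (Fin k) => recvProb k n Ω #S) G *
      if rippleSize sel G u = 0 then 0 else 1)
    (fun G => u - 1 - rippleSize sel G (u - 1)) (fun G => u - rippleSize sel G u)
    (1 - joinProb k n Ω u) (fun z => ?_) j
  · simp only [mul_assoc, ite_mul, zero_mul, one_mul] at h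
    simpa only [outsideMoment, graphMean, subsetMean, ne_eq, ite_not] using h
  · have h := graphMean_transition hM hsel (by omega) hu 1 (1 + z)
    simp only [graphMean, subsetMean, one_pow, one_mul] at h
    simp only [mul_assoc, ite_mul, zero_mul, one_mul]
    rw [h, show joinProb k n Ω u * 1 + (1 - joinProb k n Ω u) * (1 + z) =
      1 + (1 - joinProb k n Ω u) * z by ring]

theorem momentRow_eq_outsideMoment (hM : IsPoissonModel k n Ω) (hsel : IsSelectionRule sel)
    (hk : 1 ≤ k) {i : ℕ} (hi : i + 1 ≤ k) (j : ℕ) :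
    momentRow k (stepProb k n Ω) (i + 1) j = outsideMoment k n Ω sel (k - i) j := by
  induction i generalizing j with
  | zero =>
    simp only [momentRow, Nat.sub_zero]
    rw [outsideMoment_initial hk, stepProb, if_pos rfl]
  | succ i ih =>
    rw [momentRow, ih (by omega), ih (by omega), stepProb, if_neg (by omega),
      show k - (i + 1) + 1 = k - i by omega, show k - (i + 1) = k - i - 1 by omega,
      outsideMoment_step hM hsel (by omega) (by omega)]

/-- The success probability is the zeroth moment when one symbol is undecoded. -/
theorem momentRow_eq_success (hM : IsPoissonModel k n Ω) (hsel : IsSelectionRule sel)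
    (hk : 1 ≤ k) : momentRow k (stepProb k n Ω) k 0 = 1 - errorProb k n Ω sel := by
  have h := momentRow_eq_outsideMoment hM hsel hk (i := k - 1) (by omega) 0
  rw [Nat.sub_add_cancel hk, show k - (k - 1) = 1 by omega] at h
  rw [h, ← graphMean_success hsel hk, outsideMoment]
  simp only [Nat.choose_zero_right, Nat.cast_one]

end Moments

/-! ### A multiplicative difference scheme for the probabilities `q_u` -/

/-- Row `m + 1` consists of the products of neighbouring entries of row `m`; row `0` is
`1 - p_d`. -/
noncomputable def avoidTable (k : ℕ) (n : ℝ) (Ω : ℕ → ℝ) : ℕ → ℕ → ℝ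
  | 0, d => 1 - recvProb k n Ω d
  | m + 1, d => avoidTable k n Ω m d * avoidTable k n Ω m (d + 1)

theorem avoidTable_eq (k : ℕ) (n : ℝ) (Ω : ℕ → ℝ) (m d : ℕ) :
    avoidTable k n Ω m d =
      ∏ j ∈ range (m + 1), (1 - recvProb k n Ω (j + d)) ^ m.choose j := by
  induction m generalizing d with
  | zero => simp [avoidTable]
  | succ m ih =>
    rw [avoidTable, ih, ih, prod_range_succ' _ (m + 1)]
    simp only [Nat.choose_succ_succ, pow_add, prod_mul_distrib, Nat.choose_zero_right]
    rw [prod_range_succ' _ m, prod_range_succ (fun j =>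
      (1 - recvProb k n Ω (j + 1 + d)) ^ m.choose (j + 1)) m]
    simp only [Nat.choose_succ_self, pow_zero, mul_one, Nat.choose_zero_right,
      show ∀ j, j + (d + 1) = j + 1 + d by intro j; ring]
    ring

theorem one_sub_avoidTable {k : ℕ} {n : ℝ} {Ω : ℕ → ℝ} (hM : IsPoissonModel k n Ω) (u : ℕ) :
    1 - avoidTable k n Ω (k - u) 2 = joinProb k n Ω u := by
  rw [joinProb_eq hM, avoidTable_eq]

theorem avoidTable_eq_one {k : ℕ} {n : ℝ} {Ω : ℕ → ℝ} (hM : IsPoissonModel k n Ω) (m : ℕ) {d : ℕ}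
    (hd : maxDegree k Ω < d) : avoidTable k n Ω m d = 1 := by
  induction m generalizing d with
  | zero => rw [avoidTable, recvProb_eq_zero hM hd, sub_zero]
  | succ m ih => rw [avoidTable, ih hd, ih (by omega), one_mul]

theorem maxDegree_le (k : ℕ) (Ω : ℕ → ℝ) : maxDegree k Ω ≤ k :=
  Finset.sup_le fun _ hd => (mem_Icc.mp (mem_filter.mp hd).1).2

theorem one_le_maxDegree {k : ℕ} {n : ℝ} {Ω : ℕ → ℝ} (hM : IsPoissonModel k n Ω) :
    1 ≤ maxDegree k Ω := by
  obtain ⟨d, hd, h0⟩ : ∃ d ∈ Icc 1 k, Ω d ≠ 0 :=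
    exists_ne_zero_of_sum_ne_zero (by rw [hM.sum_eq_one]; exact one_ne_zero)
  exact (mem_Icc.mp hd).1.trans <| le_sup (f := id)
    (mem_filter.mpr ⟨hd, lt_of_le_of_ne (hM.nonneg d) (Ne.symm h0)⟩)

theorem maxDegree_succ (k : ℕ) (Ω : ℕ → ℝ) :
    maxDegree (k + 1) Ω = if 0 < Ω (k + 1) then k + 1 else maxDegree k Ω := by
  have h := maxDegree_le k Ω
  rw [maxDegree] at *
  rw [← insert_Icc_right_eq_Icc_add_one (by omega), filter_insert]
  split_ifs
  · rw [sup_insert]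
    exact sup_eq_left.mpr (by simpa using h.trans (Nat.le_succ k))
  · rfl

end LTCode

namespace RealRAM

/-! ### Running times of structured programs -/

/-- Started in the state `s`, the program `P` halts after at most `B` operations, in a state that
satisfies `φ`. -/
def Runs (P : Program) (s : State) (B : ℕ) (φ : State → Prop) : Prop :=
  ∃ (t : ℕ) (s' : State), Exec P s t s' ∧ t ≤ B ∧ φ s'

theorem Runs.mono {P : Program} {s : State} {B B' : ℕ} {φ ψ : State → Prop} (h : Runs P s B φ)
    (hB : B ≤ B') (hφ : ∀ s', φ s' → ψ s') : Runs P s B' ψ := by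
  obtain ⟨t, s', h1, h2, h3⟩ := h
  exact ⟨t, s', h1, h2.trans hB, hφ s' h3⟩

theorem Runs.seq {P R : Program} {s : State} {B B' : ℕ} {φ ψ : State → Prop} (hP : Runs P s B φ)
    (hR : ∀ s', φ s' → Runs R s' B' ψ) : Runs (.seq P R) s (B + B') ψ := by
  obtain ⟨t, s', h1, h2, h3⟩ := hP
  obtain ⟨t', s'', h4, h5, h6⟩ := hR s' h3
  exact ⟨t + t', s'', .seq h1 h4, Nat.add_le_add h2 h5, h6⟩

theorem Runs.ite {b : Test} {P R : Program} {s : State} {B : ℕ} {φ : State → Prop}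
    (hP : b.Holds s → Runs P s B φ) (hR : ¬ b.Holds s → Runs R s B φ) :
    Runs (.ite b P R) s (B + 1) φ := by
  by_cases hb : b.Holds s
  · obtain ⟨t, s', h1, h2, h3⟩ := hP hb
    exact ⟨t + 1, s', .iteTrue hb h1, Nat.succ_le_succ h2, h3⟩
  · obtain ⟨t, s', h1, h2, h3⟩ := hR hb
    exact ⟨t + 1, s', .iteFalse hb h1, Nat.succ_le_succ h2, h3⟩

/-- A loop with `N` passes and the invariant `I i` after `i` passes. -/
theorem Runs.while {b : Test} {P : Program} {B : ℕ} (I : ℕ → State → Prop) (N : ℕ)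
    (hb : ∀ i < N, ∀ s, I i s → b.Holds s) (hP : ∀ i < N, ∀ s, I i s → Runs P s B (I (i + 1)))
    (hN : ∀ s, I N s → ¬ b.Holds s) {s : State} (h0 : I 0 s) :
    Runs (.while b P) s (N * (B + 1) + 1) (I N) := by
  have key : ∀ m i, i + m = N → ∀ s, I i s → Runs (.while b P) s (m * (B + 1) + 1) (I N) := by
    intro m
    induction m with
    | zero =>
      rintro i hi s hs
      obtain rfl : i = N := by omega
      exact ⟨1, s, .whileFalse (hN s hs), by omega, hs⟩
    | succ m ih =>
      intro i hi s hs
      obtain ⟨t, s', h1, h2, h3⟩ := hP i (by omega) s hs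
      obtain ⟨t', s'', h4, h5, h6⟩ := ih (i + 1) (by omega) s' h3
      refine ⟨t + t' + 1, s'', .whileTrue (hb i (by omega) s hs) h1 h4, ?_, h6⟩
      rw [Nat.succ_mul]
      omega
  exact key N 0 (Nat.zero_add N) s h0

/-- A nonempty sequence of instructions. -/
def Program.block (i : Instr) : List Instr → Program
  | [] => .instr i
  | j :: l => .seq (.instr i) (Program.block j l)

/-- All instructions of the sequence can be executed one after the other. -/
def BlockDefined : State → List Instr → Prop
  | _, [] => True
  | s, i :: l => i.Defined s ∧ BlockDefined (i.run s) l

theorem Runs.block {i : Instr} {l : List Instr} {s : State} {φ : State → Prop}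
    (hd : BlockDefined s (i :: l)) (h : φ (l.foldl Instr.run (i.run s))) :
    Runs (.block i l) s (l.length + 1) φ := by
  induction l generalizing i s with
  | nil => exact ⟨1, i.run s, .instr hd.1, le_rfl, h⟩
  | cons j l ih =>
    obtain ⟨t, s', h1, h2, h3⟩ := ih (i := j) hd.2 h
    refine ⟨1 + t, s', .seq (.instr hd.1) h1, ?_, h3⟩
    rw [List.length_cons]
    omega

/-- `Function.update_self` with an equation that can be discharged by `omega`. -/
theorem update_of_eq {β : Type*} {a b : ℕ} (h : a = b) (v : β) (f : ℕ → β) :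
    Function.update f b v a = v := by
  rw [h, Function.update_self]

/-! ### The layout of the memory -/

/-- The registers that keep their values: `I[0] = k`, `I[1] = 1`, `I[9] = 0`; `I[10], …, I[18]` are
the addresses `k + 2, …, k + 10` of the real variables; the arrays start at `I[19] = k + 11` and
`I[20] = 2 k + 13`. -/
def frameIdx (k r : ℕ) : ℕ :=
  if r = 0 then k else if r = 1 then 1 else if r = 20 then 2 * k + 13
  else if 10 ≤ r ∧ r ≤ 19 then k + r - 8 else 0

/-- The fixed registers have their values, and the cells `k + 2`, `k + 3` hold `0` and `1`. -/
structure Frame (k : ℕ) (s : State) : Prop where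
  idx : ∀ r, r ≤ 1 ∨ 9 ≤ r → s.idx r = frameIdx k r
  mem_zero : s.mem (k + 2) = 0
  mem_one : s.mem (k + 3) = 1

section Frame

variable {k : ℕ} {s : State}

theorem Frame.idx0 (h : Frame k s) : s.idx 0 = k := h.idx 0 (by omega)
theorem Frame.idx1 (h : Frame k s) : s.idx 1 = 1 := h.idx 1 (by omega)
theorem Frame.idx9 (h : Frame k s) : s.idx 9 = 0 := h.idx 9 (by omega)
theorem Frame.idx10 (h : Frame k s) : s.idx 10 = k + 2 := h.idx 10 (by omega)
theorem Frame.idx11 (h : Frame k s) : s.idx 11 = k + 3 := h.idx 11 (by omega)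
theorem Frame.idx12 (h : Frame k s) : s.idx 12 = k + 4 := h.idx 12 (by omega)
theorem Frame.idx13 (h : Frame k s) : s.idx 13 = k + 5 := h.idx 13 (by omega)
theorem Frame.idx14 (h : Frame k s) : s.idx 14 = k + 6 := h.idx 14 (by omega)
theorem Frame.idx15 (h : Frame k s) : s.idx 15 = k + 7 := h.idx 15 (by omega)
theorem Frame.idx16 (h : Frame k s) : s.idx 16 = k + 8 := h.idx 16 (by omega)
theorem Frame.idx17 (h : Frame k s) : s.idx 17 = k + 9 := h.idx 17 (by omega)
theorem Frame.idx18 (h : Frame k s) : s.idx 18 = k + 10 := h.idx 18 (by omega)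
theorem Frame.idx19 (h : Frame k s) : s.idx 19 = k + 11 := h.idx 19 (by omega)
theorem Frame.idx20 (h : Frame k s) : s.idx 20 = 2 * k + 13 := h.idx 20 (by omega)

end Frame

/-- Sets the fixed registers and the cell with the value `1`, and initializes the scan of the
degrees. -/
def setupProgram : Program :=
  .seq (.block (.idxConst 1 1) [.idxAdd 10 0 1, .idxAdd 10 10 1]) <|
  .seq (.instr (.idxAdd 11 10 1)) <| .seq (.instr (.idxAdd 12 11 1)) <|
  .seq (.instr (.idxAdd 13 12 1)) <| .seq (.instr (.idxAdd 14 13 1)) <|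
  .seq (.instr (.idxAdd 15 14 1)) <| .seq (.instr (.idxAdd 16 15 1)) <|
  .seq (.instr (.idxAdd 17 16 1)) <| .seq (.instr (.idxAdd 18 17 1)) <|
  .seq (.instr (.idxAdd 19 18 1)) <|
  .seq (.block (.idxAdd 20 0 19) [.idxAdd 20 20 1, .idxAdd 20 20 1, .memConst 11 1]) <|
  .block (.idxConst 2 1) [.idxConst 5 0, .idxAdd 6 0 1]

/-- The registers `I[10], …, I[c]` are set, and the memory is unchanged. -/
structure SetupInv (k : ℕ) (mem : ℕ → ℝ) (c : ℕ) (s : State) : Prop where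
  idx : ∀ r, r ≤ 1 ∨ 9 ≤ r → r ≤ c → s.idx r = frameIdx k r
  idx_zero : ∀ r, c < r → s.idx r = 0
  mem_eq : s.mem = mem

theorem SetupInv.runs_idxAdd {k : ℕ} {mem : ℕ → ℝ} {c : ℕ} {s : State} (hs : SetupInv k mem c s)
    (h10 : 10 ≤ c) (h18 : c ≤ 18) :
    Runs (.instr (.idxAdd (c + 1) c 1)) s 1 (SetupInv k mem (c + 1)) := by
  refine Runs.block (l := []) (by simp [BlockDefined, Instr.Defined]) ?_
  constructor
  · intro r hr hrc
    by_cases h : r = c + 1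
    · subst h
      simp only [List.foldl_nil, Instr.run, Function.update_self, hs.idx c (by omega) le_rfl,
        hs.idx 1 (by omega) (by omega)]
      simp (disch := omega) only [frameIdx, if_neg, if_pos, if_true]
      omega
    · simp only [List.foldl_nil, Instr.run, Function.update_of_ne h, hs.idx r hr (by omega)]
  · intro r hr
    simp (disch := omega) only [List.foldl_nil, Instr.run, Function.update_of_ne, hs.idx_zero]
  · simp only [List.foldl_nil, Instr.run, hs.mem_eq]

/-- The invariant of the scan of the degrees: `I[5]` is the largest degree up to `d` of positive
probability, and the cell `k + 4` counts the degrees. -/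
structure ScanInv (k : ℕ) (n : ℝ) (Ω : ℕ → ℝ) (d : ℕ) (s : State) : Prop where
  frame : Frame k s
  idx2 : s.idx 2 = d + 1
  idx5 : s.idx 5 = LTCode.maxDegree d Ω
  idx6 : s.idx 6 = k + 1
  count : s.mem (k + 4) = d
  mem0 : s.mem 0 = n
  input : ∀ e, 1 ≤ e → e ≤ k → s.mem e = Ω e

theorem runs_setupProgram (k : ℕ) (n : ℝ) (Ω : ℕ → ℝ) :
    Runs setupProgram (inputState k n Ω) 19 (ScanInv k n Ω 0) := by
  refine Runs.seq (B := 3) (B' := 16) (φ := SetupInv k (inputState k n Ω).mem 10) ?_ ?_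
  · refine Runs.block (by simp [BlockDefined, Instr.Defined]) ?_
    constructor
    · intro r hr hrc
      interval_cases r <;> first | omega | simp [Instr.run, inputState, frameIdx]
    · intro r hr
      simp (disch := omega) only [List.foldl_cons, List.foldl_nil, Instr.run,
        Function.update_of_ne, inputState, if_neg]
    · rfl
  intro s h
  refine Runs.seq (B := 1) (B' := 15) (h.runs_idxAdd (by omega) (by omega)) fun s h => ?_
  refine Runs.seq (B := 1) (B' := 14) (h.runs_idxAdd (by omega) (by omega)) fun s h => ?_
  refine Runs.seq (B := 1) (B' := 13) (h.runs_idxAdd (by omega) (by omega)) fun s h => ?_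
  refine Runs.seq (B := 1) (B' := 12) (h.runs_idxAdd (by omega) (by omega)) fun s h => ?_
  refine Runs.seq (B := 1) (B' := 11) (h.runs_idxAdd (by omega) (by omega)) fun s h => ?_
  refine Runs.seq (B := 1) (B' := 10) (h.runs_idxAdd (by omega) (by omega)) fun s h => ?_
  refine Runs.seq (B := 1) (B' := 9) (h.runs_idxAdd (by omega) (by omega)) fun s h => ?_
  refine Runs.seq (B := 1) (B' := 8) (h.runs_idxAdd (by omega) (by omega)) fun s h => ?_
  refine Runs.seq (B := 1) (B' := 7) (h.runs_idxAdd (by omega) (by omega)) fun s h => ?_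
  have i0 : s.idx 0 = k := h.idx 0 (by omega) (by omega)
  have i1 : s.idx 1 = 1 := h.idx 1 (by omega) (by omega)
  have i11 : s.idx 11 = k + 3 := h.idx 11 (by omega) (by omega)
  have i19 : s.idx 19 = k + 11 := h.idx 19 (by omega) (by omega)
  refine Runs.seq (B := 4) (B' := 3) (φ := fun s' => Frame k s' ∧
    s'.mem = Function.update (inputState k n Ω).mem (k + 3) 1) ?_ ?_
  · refine Runs.block (by simp [BlockDefined, Instr.Defined]) ⟨⟨fun r hr => ?_, ?_, ?_⟩, ?_⟩
    · by_cases h20 : r = 20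
      · subst h20
        simp only [List.foldl_cons, List.foldl_nil, Instr.run, Function.update_self, ne_eq,
          OfNat.one_ne_ofNat, not_false_eq_true, Function.update_of_ne, i0, i1, i19]
        simp only [frameIdx]
        simp
        omega
      · simp only [List.foldl_cons, List.foldl_nil, Instr.run, Function.update_of_ne h20]
        by_cases hr20 : r < 20
        · exact h.idx r hr (by omega)
        · rw [h.idx_zero r (by omega)]
          simp (disch := omega) only [frameIdx, if_neg]
    · simp (disch := omega) only [List.foldl_cons, List.foldl_nil, Instr.run,
        Function.update_of_ne, i11, h.mem_eq, inputState, if_neg]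
    · simp (disch := omega) only [List.foldl_cons, List.foldl_nil, Instr.run,
        Function.update_of_ne, Function.update_self, i11, Nat.cast_one]
    · simp (disch := omega) only [List.foldl_cons, List.foldl_nil, Instr.run,
        Function.update_of_ne, i11, h.mem_eq, Nat.cast_one]
  rintro s ⟨hF, hmem⟩
  have i0 := hF.idx0
  have i1 := hF.idx1
  refine Runs.block (by simp [BlockDefined, Instr.Defined]) ?_
  constructor
  · constructor
    · intro r hr
      simp (disch := omega) only [List.foldl_cons, List.foldl_nil, Instr.run,
        Function.update_of_ne, hF.idx]
    · exact hF.mem_zero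
    · exact hF.mem_one
  · simp [Instr.run]
  · simp [Instr.run, LTCode.maxDegree]
  · simp [Instr.run, i0, i1]
  · simp (disch := omega) only [List.foldl_cons, List.foldl_nil, Instr.run, hmem,
      Function.update_of_ne, inputState, if_neg, Nat.cast_zero]
  · simp (disch := omega) only [List.foldl_cons, List.foldl_nil, Instr.run, hmem,
      Function.update_of_ne, inputState, if_true]
  · intro e h1 h2
    simp (disch := omega) only [List.foldl_cons, List.foldl_nil, Instr.run, hmem,
      Function.update_of_ne, inputState, if_neg, if_pos]

/-- Finds the largest degree of positive probability, and counts up to `k` in a memory cell, which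
makes `k` available as a real number. `I[2]` runs through the degrees. -/
def scanProgram : Program :=
  .while (.idxLt 2 6) (.seq (.instr (.memArith .add 12 12 11))
    (.ite (.memLe 2 10) (.instr (.idxAdd 2 2 1)) (.block (.idxAdd 5 2 9) [.idxAdd 2 2 1])))

theorem runs_scanProgram {k : ℕ} {n : ℝ} {Ω : ℕ → ℝ} {s : State} (hs : ScanInv k n Ω 0 s) :
    Runs scanProgram s (k * 5 + 1) (ScanInv k n Ω k) := by
  refine Runs.while (B := 4) (ScanInv k n Ω) k ?_ ?_ ?_ hs
  · intro d hd s hs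
    simp only [Test.Holds, hs.idx2, hs.idx6]
    omega
  · intro d hd s hs
    have hF := hs.frame
    have h2 := hs.idx2
    have h5 := hs.idx5
    have h9 := hF.idx9
    have h1 := hF.idx1
    have h11 := hF.idx11
    have h12 := hF.idx12
    have hc := hs.count
    have hone := hF.mem_one
    have hΩ : s.mem (d + 1) = Ω (d + 1) := hs.input _ (by omega) (by omega)
    refine Runs.seq (B := 1) (B' := 3)
      (φ := fun s' => s' = ⟨s.idx, Function.update s.mem (k + 4) ((d + 1 : ℕ) : ℝ)⟩)
      (Runs.block (l := []) (by simp [BlockDefined, Instr.Defined]) ?_) ?_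
    · simp only [List.foldl_nil, Instr.run, h12, h11, ArithOp.eval, hc, hone]
      push_cast
      rfl
    · rintro _ rfl
      have htest : (Test.memLe 2 10).Holds
          ⟨s.idx, Function.update s.mem (k + 4) ((d + 1 : ℕ) : ℝ)⟩ ↔ ¬ 0 < Ω (d + 1) := by
        simp (disch := omega) only [Test.Holds, h2, hF.idx10, Function.update_of_ne, hΩ,
          hF.mem_zero, not_lt]
      refine Runs.ite (B := 2) (fun hb => ?_) (fun hb => ?_)
      · refine (Runs.block (l := []) (by simp [BlockDefined, Instr.Defined]) ?_).mono
          (B := 1) (by omega) fun _ h => h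
        rw [htest] at hb
        constructor
        · constructor
          · intro r hr
            simp (disch := omega) only [List.foldl_nil, Instr.run, Function.update_of_ne, hF.idx]
          · simp (disch := omega) only [List.foldl_nil, Instr.run, Function.update_of_ne,
              hF.mem_zero]
          · simp (disch := omega) only [List.foldl_nil, Instr.run, Function.update_of_ne,
              hF.mem_one]
        · simp only [List.foldl_nil, Instr.run, Function.update_self, h2, h1]
        · simp (disch := omega) only [List.foldl_nil, Instr.run, Function.update_of_ne, h5,
            LTCode.maxDegree_succ, if_neg hb]
        · simp (disch := omega) only [List.foldl_nil, Instr.run, Function.update_of_ne, hs.idx6]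
        · simp only [List.foldl_nil, Instr.run, Function.update_self]
        · simp (disch := omega) only [List.foldl_nil, Instr.run, Function.update_of_ne, hs.mem0]
        · intro e he1 he2
          simp (disch := omega) only [List.foldl_nil, Instr.run, Function.update_of_ne, hs.input]
      · refine Runs.block (by simp [BlockDefined, Instr.Defined]) ?_
        rw [htest, not_not] at hb
        constructor
        · constructor
          · intro r hr
            simp (disch := omega) only [List.foldl_cons, List.foldl_nil, Instr.run,
              Function.update_of_ne, hF.idx]
          · simp (disch := omega) only [List.foldl_cons, List.foldl_nil, Instr.run,
              Function.update_of_ne, hF.mem_zero]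
          · simp (disch := omega) only [List.foldl_cons, List.foldl_nil, Instr.run,
              Function.update_of_ne, hF.mem_one]
        · simp (disch := omega) only [List.foldl_cons, List.foldl_nil, Instr.run,
            Function.update_self, Function.update_of_ne, h2, h1]
        · simp (disch := omega) only [List.foldl_cons, List.foldl_nil, Instr.run,
            Function.update_self, Function.update_of_ne, h2, h9, LTCode.maxDegree_succ, if_pos hb,
            add_zero]
        · simp (disch := omega) only [List.foldl_cons, List.foldl_nil, Instr.run,
            Function.update_of_ne, hs.idx6]
        · simp only [List.foldl_cons, List.foldl_nil, Instr.run, Function.update_self]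
        · simp (disch := omega) only [List.foldl_cons, List.foldl_nil, Instr.run,
            Function.update_of_ne, hs.mem0]
        · intro e he1 he2
          simp (disch := omega) only [List.foldl_cons, List.foldl_nil, Instr.run,
            Function.update_of_ne, hs.input]
  · intro s hs
    simp only [Test.Holds, hs.idx2, hs.idx6]
    omega

/-! ### The first row of the difference scheme -/

/-- The invariant of the computation of `1 - p_e` (in the cell `k + 11 + e`) and `binom(k, e)` (in
the cell `2 k + 13 + e`) for `e ≤ d`. The cells `k + 4`, `k + 5`, `k + 6` hold `k - d`, `d + 1` and
`binom(k, d)`. -/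
structure TableInv (k : ℕ) (n : ℝ) (Ω : ℕ → ℝ) (d : ℕ) (s : State) : Prop where
  frame : Frame k s
  idx2 : s.idx 2 = d + 1
  idx3 : s.idx 3 = k + 12 + d
  idx4 : s.idx 4 = 2 * k + 13 + d
  idx5 : s.idx 5 = LTCode.maxDegree k Ω
  idx6 : s.idx 6 = k + 1
  rest : s.mem (k + 4) = (k : ℝ) - d
  next : s.mem (k + 5) = (d : ℝ) + 1
  binom : s.mem (k + 6) = k.choose d
  mem0 : s.mem 0 = n
  input : ∀ e, 1 ≤ e → e ≤ k → s.mem e = Ω e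
  avoid : ∀ e, 1 ≤ e → e ≤ d → s.mem (k + 11 + e) = 1 - LTCode.recvProb k n Ω e
  choose : ∀ j, j ≤ d → s.mem (2 * k + 13 + j) = k.choose j

/-- Computes `1 - p_d` and the binomial coefficients `binom(k, d)` for all `d`. `I[2]` is `d`, and
`I[3]`, `I[4]` point to the cells for `1 - p_d` and `binom(k, d)`. -/
def tableProgram : Program :=
  .seq (.block (.idxConst 2 1) [.idxAdd 3 19 1, .idxAdd 4 20 9, .memCopy 13 11, .memCopy 14 11,
    .memCopy 4 11]) <|
  .while (.idxLt 2 6) (.block (.memArith .mul 14 14 12) [.memArith .div 14 14 13, .idxAdd 4 4 1,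
    .memCopy 4 14, .memArith .mul 15 9 2, .memArith .div 15 15 14, .memArith .sub 3 11 15,
    .memArith .sub 12 12 11, .memArith .add 13 13 11, .idxAdd 3 3 1, .idxAdd 2 2 1])

/-- The recursion for the binomial coefficients of one row. -/
theorem choose_mul_div (k d : ℕ) (hd : d ≤ k) :
    (k.choose d : ℝ) * (k - d) / (d + 1) = k.choose (d + 1) := by
  have h := Nat.choose_succ_right_eq k d
  have h' : (k.choose (d + 1) : ℝ) * (d + 1) = k.choose d * (k - d) := by
    rw [← Nat.cast_sub hd]
    exact_mod_cast h
  rw [div_eq_iff (by positivity), h']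

theorem runs_tableInit {k : ℕ} {n : ℝ} {Ω : ℕ → ℝ} {s : State} (hs : ScanInv k n Ω k s) :
    Runs (.block (.idxConst 2 1) [.idxAdd 3 19 1, .idxAdd 4 20 9, .memCopy 13 11, .memCopy 14 11,
      .memCopy 4 11]) s 6 (TableInv k n Ω 0) := by
  have hF := hs.frame
  have h19 := hF.idx19
  have h20 := hF.idx20
  have h9 := hF.idx9
  have h1 := hF.idx1
  have h11 := hF.idx11
  have h13 := hF.idx13
  have h14 := hF.idx14
  have hone := hF.mem_one
  refine Runs.block (by simp [BlockDefined, Instr.Defined]) ?_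
  constructor
  · constructor
    · intro r hr
      simp (disch := omega) only [List.foldl_cons, List.foldl_nil, Instr.run,
        Function.update_of_ne, hF.idx]
    · simp (disch := omega) only [List.foldl_cons, List.foldl_nil, Instr.run,
        Function.update_of_ne, update_of_eq, hF.mem_zero, h11, h13, h14, h20, h9]
    · simp (disch := omega) only [List.foldl_cons, List.foldl_nil, Instr.run,
        Function.update_of_ne, update_of_eq, hone, h11, h13, h14, h20, h9]
  · simp (disch := omega) only [List.foldl_cons, List.foldl_nil, Instr.run,
      Function.update_of_ne, update_of_eq]
  · simp (disch := omega) only [List.foldl_cons, List.foldl_nil, Instr.run,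
      Function.update_of_ne, update_of_eq, h19, h1, add_zero]
  · simp (disch := omega) only [List.foldl_cons, List.foldl_nil, Instr.run,
      Function.update_of_ne, update_of_eq, h20, h9]
  · simp (disch := omega) only [List.foldl_cons, List.foldl_nil, Instr.run,
      Function.update_of_ne, update_of_eq, hs.idx5]
  · simp (disch := omega) only [List.foldl_cons, List.foldl_nil, Instr.run,
      Function.update_of_ne, update_of_eq, hs.idx6]
  · simp (disch := omega) only [List.foldl_cons, List.foldl_nil, Instr.run,
      Function.update_of_ne, update_of_eq, hs.count, h11, h13, h14, h20, h9, Nat.cast_zero,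
      sub_zero]
  · simp (disch := omega) only [List.foldl_cons, List.foldl_nil, Instr.run,
      Function.update_of_ne, update_of_eq, hone, h11, h13, h14, h20, h9, Nat.cast_zero, zero_add]
  · simp (disch := omega) only [List.foldl_cons, List.foldl_nil, Instr.run,
      Function.update_of_ne, update_of_eq, hone, h11, h13, h14, h20, h9, Nat.choose_zero_right,
      Nat.cast_one]
  · simp (disch := omega) only [List.foldl_cons, List.foldl_nil, Instr.run,
      Function.update_of_ne, update_of_eq, hs.mem0, h11, h13, h14, h20, h9]
  · intro e he1 he2
    simp (disch := omega) only [List.foldl_cons, List.foldl_nil, Instr.run,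
      Function.update_of_ne, update_of_eq, hs.input, h11, h13, h14, h20, h9]
  · intro e he1 he2
    omega
  · intro j hj
    obtain rfl : j = 0 := by omega
    simp (disch := omega) only [List.foldl_cons, List.foldl_nil, Instr.run,
      Function.update_of_ne, update_of_eq, hone, h11, h13, h14, h20, h9, Nat.choose_zero_right,
      Nat.cast_one]

set_option maxHeartbeats 400000 in
theorem runs_tableBody {k : ℕ} {n : ℝ} {Ω : ℕ → ℝ} {s : State} {d : ℕ} (hd : d < k)
    (hs : TableInv k n Ω d s) :
    Runs (.block (.memArith .mul 14 14 12) [.memArith .div 14 14 13, .idxAdd 4 4 1,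
    .memCopy 4 14, .memArith .mul 15 9 2, .memArith .div 15 15 14, .memArith .sub 3 11 15,
    .memArith .sub 12 12 11, .memArith .add 13 13 11, .idxAdd 3 3 1, .idxAdd 2 2 1])
      s 11 (TableInv k n Ω (d + 1)) := by
  have hF := hs.frame
  have h2 := hs.idx2
  have h3 := hs.idx3
  have h4 := hs.idx4
  have h1 := hF.idx1
  have h9 := hF.idx9
  have h11 := hF.idx11
  have h12 := hF.idx12
  have h13 := hF.idx13
  have h14 := hF.idx14
  have h15 := hF.idx15
  have hone := hF.mem_one
  have hrest := hs.rest
  have hnext := hs.next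
  have hbin := hs.binom
  have hmem0 := hs.mem0
  have hΩ : s.mem (d + 1) = Ω (d + 1) := hs.input _ (by omega) (by omega)
  have hch := choose_mul_div k d hd.le
  have hd0 : (d : ℝ) + 1 ≠ 0 := by positivity
  have hc0 : (k.choose (d + 1) : ℝ) ≠ 0 :=
    Nat.cast_ne_zero.mpr (Nat.choose_pos (by omega)).ne'
  have hrun : [.memArith .div 14 14 13, .idxAdd 4 4 1, .memCopy 4 14, .memArith .mul 15 9 2,
      .memArith .div 15 15 14, .memArith .sub 3 11 15, .memArith .sub 12 12 11,
      .memArith .add 13 13 11, .idxAdd 3 3 1, .idxAdd 2 2 1].foldl Instr.run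
        (Instr.run s (.memArith .mul 14 14 12)) =
      ⟨Function.update (Function.update (Function.update s.idx 4 (2 * k + 13 + d + 1))
        3 (k + 12 + d + 1)) 2 (d + 1 + 1),
      Function.update (Function.update (Function.update (Function.update (Function.update
        (Function.update (Function.update (Function.update s.mem
          (k + 6) (k.choose d * (k - d))) (k + 6) (k.choose (d + 1)))
          (2 * k + 13 + d + 1) (k.choose (d + 1))) (k + 7) (n * Ω (d + 1)))
          (k + 7) (LTCode.recvProb k n Ω (d + 1)))
          (k + 12 + d) (1 - LTCode.recvProb k n Ω (d + 1)))
          (k + 4) (k - d - 1)) (k + 5) (d + 1 + 1)⟩ := by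
    simp (disch := omega) only [List.foldl_cons, List.foldl_nil, Instr.run, ArithOp.eval,
      Function.update_of_ne, update_of_eq, h1, h2, h3, h4, h9, h11, h12, h13, h14, h15, hone,
      hrest, hnext, hbin, hmem0, hΩ, hch, LTCode.recvProb]
  refine Runs.block ?_ ?_
  · simp (disch := omega) only [BlockDefined, Instr.Defined, Instr.run, ArithOp.eval,
      Function.update_of_ne, update_of_eq, h1, h2, h4, h9, h12, h13, h14, h15,
      hrest, hnext, hbin, hmem0, hΩ, hch, ne_eq, hd0, hc0, not_false_eq_true, and_self]
  · rw [hrun]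
    constructor
    · constructor
      · intro r hr
        simp (disch := omega) only [Function.update_of_ne, hF.idx]
      · simp (disch := omega) only [Function.update_of_ne, hF.mem_zero]
      · simp (disch := omega) only [Function.update_of_ne, hF.mem_one]
    · simp (disch := omega) only [update_of_eq]
    · simp (disch := omega) only [Function.update_of_ne, update_of_eq]
      omega
    · simp (disch := omega) only [Function.update_of_ne, update_of_eq]
      omega
    · simp (disch := omega) only [Function.update_of_ne, hs.idx5]
    · simp (disch := omega) only [Function.update_of_ne, hs.idx6]
    · simp (disch := omega) only [Function.update_of_ne, update_of_eq]
      push_cast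
      ring
    · simp (disch := omega) only [update_of_eq]
      push_cast
      ring
    · simp (disch := omega) only [Function.update_of_ne, update_of_eq]
    · simp (disch := omega) only [Function.update_of_ne, hmem0]
    · intro e he1 he2
      simp (disch := omega) only [Function.update_of_ne, hs.input]
    · intro e he1 he2
      by_cases hed : e = d + 1
      · subst hed
        simp (disch := omega) only [Function.update_of_ne, update_of_eq]
      · simp (disch := omega) only [Function.update_of_ne, hs.avoid]
    · intro j hj
      by_cases hjd : j = d + 1
      · subst hjd
        simp (disch := omega) only [Function.update_of_ne, update_of_eq]
      · simp (disch := omega) only [Function.update_of_ne, hs.choose]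

theorem runs_tableProgram {k : ℕ} {n : ℝ} {Ω : ℕ → ℝ} {s : State} (hs : ScanInv k n Ω k s) :
    Runs tableProgram s (6 + (k * 12 + 1)) (TableInv k n Ω k) := by
  refine Runs.seq (runs_tableInit hs) fun s hs => ?_
  refine Runs.while (B := 11) (TableInv k n Ω) k ?_ ?_ ?_ hs
  · intro d hd s hs
    simp only [Test.Holds, hs.idx2, hs.idx6]
    omega
  · exact fun d hd s hs => runs_tableBody hd hs
  · intro s hs
    simp only [Test.Holds, hs.idx2, hs.idx6]
    omega

/-! ### The program for `q_1, …, q_k` -/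

/-- The invariant of the computation of `q_u` (in the cell `u`) for `k - m < u ≤ k`. The row `m` of
the difference scheme is kept in the cells `k + 11 + d` for `2 ≤ d ≤ D + 1`. -/
structure JoinInv (k : ℕ) (n : ℝ) (Ω : ℕ → ℝ) (m : ℕ) (s : State) : Prop where
  frame : Frame k s
  idx2 : s.idx 2 = k - m
  idx7 : s.idx 7 = k + 13
  idx8 : s.idx 8 = k + 12 + LTCode.maxDegree k Ω
  next : s.mem (k + 5) = (k : ℝ) + 1
  avoid_one : s.mem (k + 12) = 1 - LTCode.recvProb k n Ω 1
  avoid : ∀ d, 2 ≤ d → d ≤ LTCode.maxDegree k Ω + 1 →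
    s.mem (k + 11 + d) = LTCode.avoidTable k n Ω m d
  join : ∀ u, k - m < u → u ≤ k → s.mem u = 1 - LTCode.avoidTable k n Ω (k - u) 2
  choose : ∀ j, j ≤ k → s.mem (2 * k + 13 + j) = k.choose j

/-- Replaces a row of the difference scheme by the next one. `I[3]` and `I[4]` point to neighbouring
entries, and `I[8]` is the address of the entry `D + 1`, which is always `1`. -/
def rowProgram : Program :=
  .while (.idxLt 3 8) (.block (.memArith .mul 3 3 4) [.idxAdd 3 3 1, .idxAdd 4 4 1])

/-- Stores `q_u` for `u = k, …, 1`, where `I[2]` is `u` and `I[7]` is the address of the entry `2`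
of the row. The first block sets the entry `k + 1` to `1`, which is needed if `D = k`. -/
def joinLoopProgram : Program :=
  .seq (.block (.memCopy 3 11) [.idxAdd 2 0 9, .idxAdd 7 19 1, .idxAdd 7 7 1, .idxAdd 8 19 5,
    .idxAdd 8 8 1]) <|
  .while (.idxLt 9 2) (.seq (.block (.memArith .sub 2 11 7) [.idxAdd 3 7 9, .idxAdd 4 7 1]) <|
    .seq rowProgram (.instr (.idxSub 2 2 1)))

/-- The program for `q_1, …, q_k`. -/
def joinProgram : Program :=
  .seq setupProgram <| .seq scanProgram <| .seq tableProgram joinLoopProgram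

theorem runs_joinInit {k : ℕ} {n : ℝ} {Ω : ℕ → ℝ} (hM : LTCode.IsPoissonModel k n Ω) {s : State}
    (hs : TableInv k n Ω k s) :
    Runs (.block (.memCopy 3 11) [.idxAdd 2 0 9, .idxAdd 7 19 1, .idxAdd 7 7 1, .idxAdd 8 19 5,
      .idxAdd 8 8 1]) s 6 (JoinInv k n Ω 0) := by
  have hF := hs.frame
  have h0 := hF.idx0
  have h1 := hF.idx1
  have h3 := hs.idx3
  have h5 := hs.idx5
  have h9 := hF.idx9
  have h11 := hF.idx11
  have h19 := hF.idx19
  have hone := hF.mem_one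
  have hD := LTCode.maxDegree_le k Ω
  have hD1 := LTCode.one_le_maxDegree hM
  have hrun : [.idxAdd 2 0 9, .idxAdd 7 19 1, .idxAdd 7 7 1, .idxAdd 8 19 5,
      .idxAdd 8 8 1].foldl Instr.run (Instr.run s (.memCopy 3 11)) =
      ⟨Function.update (Function.update (Function.update (Function.update (Function.update s.idx
        2 k) 7 (k + 12)) 7 (k + 13)) 8 (k + 11 + LTCode.maxDegree k Ω))
        8 (k + 12 + LTCode.maxDegree k Ω), Function.update s.mem (k + 12 + k) 1⟩ := by
    simp (disch := omega) only [List.foldl_cons, List.foldl_nil, Instr.run,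
      Function.update_of_ne, update_of_eq, h0, h1, h3, h5, h9, h11, h19, hone, add_zero]
    rw [show k + 11 + LTCode.maxDegree k Ω + 1 = k + 12 + LTCode.maxDegree k Ω by omega]
  refine Runs.block (by simp [BlockDefined, Instr.Defined]) ?_
  rw [hrun]
  constructor
  · constructor
    · intro r hr
      simp (disch := omega) only [Function.update_of_ne, hF.idx]
    · simp (disch := omega) only [Function.update_of_ne, hF.mem_zero]
    · simp (disch := omega) only [Function.update_of_ne, hF.mem_one]
  · simp (disch := omega) only [Function.update_of_ne, update_of_eq, Nat.sub_zero]
  · simp (disch := omega) only [Function.update_of_ne, update_of_eq]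
  · simp (disch := omega) only [update_of_eq]
  · simp (disch := omega) only [Function.update_of_ne, hs.next]
  · rw [← hs.avoid 1 le_rfl (by omega)]
    simp (disch := omega) only [Function.update_of_ne]
  · intro d hd1 hd2
    by_cases hd : d = k + 1
    · rw [LTCode.avoidTable_eq_one hM 0 (by omega)]
      simp (disch := omega) only [update_of_eq]
    · simp (disch := omega) only [Function.update_of_ne, hs.avoid, LTCode.avoidTable]
  · intro u hu1 hu2
    omega
  · intro j hj
    simp (disch := omega) only [Function.update_of_ne, hs.choose]

/-- The update of the row happens in place: the entry `d` is overwritten after its last use. -/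
theorem runs_rowProgram {k : ℕ} {n : ℝ} {Ω : ℕ → ℝ} {m : ℕ} {s : State}
    (hM : LTCode.IsPoissonModel k n Ω) (hF : Frame k s) (h3 : s.idx 3 = k + 13)
    (h4 : s.idx 4 = k + 14) (h8 : s.idx 8 = k + 12 + LTCode.maxDegree k Ω)
    (hrow : ∀ d, 2 ≤ d → d ≤ LTCode.maxDegree k Ω + 1 →
      s.mem (k + 11 + d) = LTCode.avoidTable k n Ω m d) :
    Runs rowProgram s ((LTCode.maxDegree k Ω - 1) * 4 + 1) fun s' =>
      (∀ r, r ≠ 3 → r ≠ 4 → s'.idx r = s.idx r) ∧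
      (∀ a, a < k + 13 ∨ k + 12 + LTCode.maxDegree k Ω ≤ a → s'.mem a = s.mem a) ∧
      ∀ d, 2 ≤ d → d ≤ LTCode.maxDegree k Ω →
        s'.mem (k + 11 + d) = LTCode.avoidTable k n Ω (m + 1) d := by
  have hD1 := LTCode.one_le_maxDegree hM
  refine (Runs.while (B := 3) (fun i s' => (s'.idx 3 = k + 13 + i ∧ s'.idx 4 = k + 14 + i) ∧
      (∀ r, r ≠ 3 → r ≠ 4 → s'.idx r = s.idx r) ∧
      (∀ a, a < k + 13 ∨ k + 13 + i ≤ a → s'.mem a = s.mem a) ∧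
      ∀ d, 2 ≤ d → d < 2 + i → s'.mem (k + 11 + d) = LTCode.avoidTable k n Ω (m + 1) d)
    (LTCode.maxDegree k Ω - 1) ?_ ?_ ?_ ?_).mono le_rfl ?_
  · rintro i hi s' ⟨⟨i3, -⟩, hr, -⟩
    simp only [Test.Holds, i3, hr 8 (by omega) (by omega), h8]
    omega
  · rintro i hi s' ⟨⟨i3, i4⟩, hr, hm, hd⟩
    have i1 : s'.idx 1 = 1 := by rw [hr 1 (by omega) (by omega), hF.idx1]
    have hv3 : s'.mem (k + 13 + i) = LTCode.avoidTable k n Ω m (i + 2) := by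
      rw [hm _ (by omega), ← hrow (i + 2) (by omega) (by omega)]
      congr 1
      omega
    have hv4 : s'.mem (k + 14 + i) = LTCode.avoidTable k n Ω m (i + 2 + 1) := by
      rw [hm _ (by omega), ← hrow (i + 2 + 1) (by omega) (by omega)]
      congr 1
      omega
    have hrun : [.idxAdd 3 3 1, .idxAdd 4 4 1].foldl Instr.run
        (Instr.run s' (.memArith .mul 3 3 4)) =
        ⟨Function.update (Function.update s'.idx 3 (k + 13 + i + 1)) 4 (k + 14 + i + 1),
          Function.update s'.mem (k + 13 + i) (LTCode.avoidTable k n Ω (m + 1) (i + 2))⟩ := by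
      simp (disch := omega) only [List.foldl_cons, List.foldl_nil, Instr.run, ArithOp.eval,
        Function.update_of_ne, i3, i4, i1, hv3, hv4, LTCode.avoidTable]
    refine Runs.block (by simp [BlockDefined, Instr.Defined]) ?_
    rw [hrun]
    refine ⟨⟨?_, ?_⟩, ?_, ?_, ?_⟩
    · simp (disch := omega) only [Function.update_of_ne, update_of_eq]
      omega
    · simp (disch := omega) only [update_of_eq]
      omega
    · intro r h3 h4
      simp (disch := omega) only [Function.update_of_ne, hr]
    · intro a ha
      simp (disch := omega) only [Function.update_of_ne, hm]
    · intro d hd1 hd2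
      by_cases hdi : d = i + 2
      · subst hdi
        simp (disch := omega) only [update_of_eq]
      · simp (disch := omega) only [Function.update_of_ne, hd]
  · rintro s' ⟨⟨i3, -⟩, hr, -⟩
    simp only [Test.Holds, i3, hr 8 (by omega) (by omega), h8]
    omega
  · exact ⟨⟨h3, h4⟩, fun r _ _ => rfl, fun a _ => rfl, fun d _ _ => by omega⟩
  · rintro s' ⟨-, hr, hm, hd⟩
    exact ⟨hr, fun a ha => hm a (by omega), fun d hd1 hd2 => hd d hd1 (by omega)⟩

theorem runs_joinBody {k : ℕ} {n : ℝ} {Ω : ℕ → ℝ} (hM : LTCode.IsPoissonModel k n Ω) {m : ℕ}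
    (hm : m < k) {s : State} (hs : JoinInv k n Ω m s) :
    Runs (.seq (.block (.memArith .sub 2 11 7) [.idxAdd 3 7 9, .idxAdd 4 7 1]) <|
      .seq rowProgram (.instr (.idxSub 2 2 1))) s (4 * LTCode.maxDegree k Ω + 5)
      (JoinInv k n Ω (m + 1)) := by
  have hD1 := LTCode.one_le_maxDegree hM
  have hD := LTCode.maxDegree_le k Ω
  have hF := hs.frame
  have h1 := hF.idx1
  have h2 := hs.idx2
  have h7 := hs.idx7
  have h9 := hF.idx9
  have h11 := hF.idx11
  have hone := hF.mem_one
  have hT : s.mem (k + 13) = LTCode.avoidTable k n Ω m 2 := hs.avoid 2 le_rfl (by omega)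
  have hrun : [.idxAdd 3 7 9, .idxAdd 4 7 1].foldl Instr.run
      (Instr.run s (.memArith .sub 2 11 7)) =
      ⟨Function.update (Function.update s.idx 3 (k + 13)) 4 (k + 14),
        Function.update s.mem (k - m) (1 - LTCode.avoidTable k n Ω m 2)⟩ := by
    simp (disch := omega) only [List.foldl_cons, List.foldl_nil, Instr.run, ArithOp.eval,
      Function.update_of_ne, h1, h2, h7, h9, h11, hone, hT, add_zero]
  refine (Runs.seq (B := 3) (φ := fun s' => s' = ⟨Function.update (Function.update s.idx 3 (k + 13))
    4 (k + 14), Function.update s.mem (k - m) (1 - LTCode.avoidTable k n Ω m 2)⟩)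
    (Runs.block (by simp [BlockDefined, Instr.Defined]) hrun) ?_).mono
    (B := 3 + ((LTCode.maxDegree k Ω - 1) * 4 + 1 + 1)) (by omega) fun _ h => h
  rintro _ rfl
  refine Runs.seq (runs_rowProgram (n := n) (m := m) hM ?_ ?_ ?_ ?_ ?_) ?_
  · constructor
    · intro r hr
      simp (disch := omega) only [Function.update_of_ne, hF.idx]
    · simp (disch := omega) only [Function.update_of_ne, hF.mem_zero]
    · simp (disch := omega) only [Function.update_of_ne, hF.mem_one]
  · simp (disch := omega) only [Function.update_of_ne, update_of_eq]
  · simp (disch := omega) only [update_of_eq]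
  · simp (disch := omega) only [Function.update_of_ne, hs.idx8]
  · intro d hd1 hd2
    simp (disch := omega) only [Function.update_of_ne, hs.avoid]
  rintro s' ⟨hr, hm', hd⟩
  have hidx : ∀ r, r ≠ 3 → r ≠ 4 → s'.idx r = s.idx r := by
    intro r h3 h4
    rw [hr r h3 h4]
    simp (disch := omega) only [Function.update_of_ne]
  have hmem : ∀ a, a ≠ k - m → a < k + 13 ∨ k + 12 + LTCode.maxDegree k Ω ≤ a →
      s'.mem a = s.mem a := by
    intro a ha ha'
    rw [hm' a ha']
    simp (disch := omega) only [Function.update_of_ne]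
  have hnew : s'.mem (k - m) = 1 - LTCode.avoidTable k n Ω m 2 := by
    rw [hm' _ (by omega)]
    simp (disch := omega) only [update_of_eq]
  refine Runs.block (l := []) (by simp [BlockDefined, Instr.Defined]) ?_
  simp only [List.foldl_nil, Instr.run]
  constructor
  · constructor
    · intro r hr
      simp (disch := omega) only [Function.update_of_ne, hidx, hF.idx]
    · simp (disch := omega) only [hmem, hF.mem_zero]
    · simp (disch := omega) only [hmem, hF.mem_one]
  · simp (disch := omega) only [update_of_eq, hidx, h2, h1]
    omega
  · simp (disch := omega) only [Function.update_of_ne, hidx, h7]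
  · simp (disch := omega) only [Function.update_of_ne, hidx, hs.idx8]
  · simp (disch := omega) only [hmem, hs.next]
  · simp (disch := omega) only [hmem, hs.avoid_one]
  · intro d hd1 hd2
    by_cases hdD : d = LTCode.maxDegree k Ω + 1
    · simp (disch := omega) only [hmem, hs.avoid, LTCode.avoidTable_eq_one hM]
    · exact hd d hd1 (by omega)
  · intro u hu1 hu2
    by_cases hu : u = k - m
    · subst hu
      rw [hnew, show k - (k - m) = m by omega]
    · simp (disch := omega) only [hmem, hs.join]
  · intro j hj
    simp (disch := omega) only [hmem, hs.choose]

theorem runs_joinProgram {k : ℕ} {n : ℝ} {Ω : ℕ → ℝ} (hM : LTCode.IsPoissonModel k n Ω) :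
    Runs joinProgram (inputState k n Ω) (4 * LTCode.maxDegree k Ω * k + 23 * k + 34)
      (JoinInv k n Ω k) := by
  have hloop : ∀ s, TableInv k n Ω k s → Runs joinLoopProgram s
      (6 + (k * (4 * LTCode.maxDegree k Ω + 5 + 1) + 1)) (JoinInv k n Ω k) := by
    intro s hs
    refine Runs.seq (runs_joinInit hM hs) fun s hs => Runs.while (JoinInv k n Ω) k ?_ ?_ ?_ hs
    · intro m hm s hs
      simp only [Test.Holds, hs.frame.idx9, hs.idx2]
      omega
    · exact fun m hm s hs => runs_joinBody hM hm hs
    · intro s hs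
      simp only [Test.Holds, hs.frame.idx9, hs.idx2]
      omega
  refine (Runs.seq (runs_setupProgram k n Ω) fun s hs => Runs.seq (runs_scanProgram hs)
    fun s hs => Runs.seq (runs_tableProgram hs) hloop).mono (le_of_eq ?_) fun _ h => h
  ring

/-! ### The program for the error probability -/

/-- The invariant of the computation of the moments: the row `i` of the moments is kept in the cells
`2 k + 13 + j` for `j ≤ k - i`, and the cell `k + 10` holds `k - i`. -/
structure MomentInv (k : ℕ) (n : ℝ) (Ω : ℕ → ℝ) (i : ℕ) (s : State) : Prop where
  frame : Frame k s
  idx2 : s.idx 2 = k - i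
  idx3 : s.idx 3 = k - i + 1
  rest : s.mem (k + 10) = ((k - i : ℕ) : ℝ)
  step : ∀ u, 1 ≤ u → u ≤ k + 1 → s.mem u = LTCode.stepProb k n Ω u
  moment : ∀ j, j ≤ k - i →
    s.mem (2 * k + 13 + j) = LTCode.momentRow k (LTCode.stepProb k n Ω) i j

/-- Scales the cell `2 k + 13 + j` by the `j`-th power of the cell `k + 9`; the cell `k + 8` holds
the powers. -/
def scaleProgram : Program :=
  .while (.idxLt 4 6) (.block (.memArith .mul 4 4 16) [.memArith .mul 16 16 17, .idxAdd 4 4 1])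

/-- Subtracts `binom(m, j)` times the `m`-th moment from the `j`-th moment, for `j < m`. `I[4]` and
`I[5]` point to these moments. -/
def subtractProgram : Program :=
  .while (.idxLt 4 5) (.block (.memArith .mul 15 14 5) [.memArith .sub 4 4 15,
    .memArith .mul 14 14 12, .memArith .div 14 14 13, .memArith .sub 12 12 11,
    .memArith .add 13 13 11, .idxAdd 4 4 1])

/-- Scales the moments by the powers of `1 - q_u`. -/
def stepScaleProgram : Program :=
  .seq (.block (.memArith .sub 17 11 3) [.memCopy 16 11, .idxAdd 4 20 9, .idxAdd 5 20 2,
    .idxAdd 6 5 1]) scaleProgram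

/-- Removes the part of the moments that belongs to an empty ripple. -/
def stepSubtractProgram : Program :=
  .seq (.block (.idxAdd 4 20 9) [.memCopy 12 18, .memCopy 13 11, .memCopy 14 11]) subtractProgram

/-- One step of the decoder: from the moments for `u` to those for `u - 1` undecoded symbols. -/
def stepProgram : Program :=
  .seq stepScaleProgram <| .seq stepSubtractProgram <|
  .block (.memArith .sub 18 18 11) [.idxSub 2 2 1, .idxSub 3 3 1]

/-- The program for the error probability. The cell `k + 1` receives `p_1`, the probability for the
formation of the initial ripple; `I[2]` is the index `m` of the moment that is eliminated. -/
def errorProgram : Program :=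
  .seq joinProgram <|
  .seq (.block (.idxAdd 3 0 1) [.idxAdd 4 19 1, .memArith .sub 3 11 4, .memArith .sub 18 13 11,
    .idxAdd 2 0 9]) <|
  .seq (.while (.idxLt 9 2) stepProgram) (.instr (.memArith .sub 9 11 20))

theorem runs_momentInit {k : ℕ} {n : ℝ} {Ω : ℕ → ℝ} (hM : LTCode.IsPoissonModel k n Ω) {s : State}
    (hs : JoinInv k n Ω k s) :
    Runs (.block (.idxAdd 3 0 1) [.idxAdd 4 19 1, .memArith .sub 3 11 4, .memArith .sub 18 13 11,
      .idxAdd 2 0 9]) s 5 (MomentInv k n Ω 0) := by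
  have hF := hs.frame
  have h0 := hF.idx0
  have h1 := hF.idx1
  have h9 := hF.idx9
  have h11 := hF.idx11
  have h13 := hF.idx13
  have h18 := hF.idx18
  have h19 := hF.idx19
  have hone := hF.mem_one
  have hnext := hs.next
  have hT := hs.avoid_one
  have hrun : [.idxAdd 4 19 1, .memArith .sub 3 11 4, .memArith .sub 18 13 11,
      .idxAdd 2 0 9].foldl Instr.run (Instr.run s (.idxAdd 3 0 1)) =
      ⟨Function.update (Function.update (Function.update s.idx 3 (k + 1)) 4 (k + 12)) 2 k,
        Function.update (Function.update s.mem (k + 1) (LTCode.recvProb k n Ω 1)) (k + 10) k⟩ := by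
    simp (disch := omega) only [List.foldl_cons, List.foldl_nil, Instr.run, ArithOp.eval,
      Function.update_of_ne, update_of_eq, h0, h1, h9, h11, h13, h18, h19, hone, hnext, hT,
      add_zero, sub_sub_cancel, add_sub_cancel_right]
  refine Runs.block (by simp [BlockDefined, Instr.Defined]) ?_
  rw [hrun]
  constructor
  · constructor
    · intro r hr
      simp (disch := omega) only [Function.update_of_ne, hF.idx]
    · simp (disch := omega) only [Function.update_of_ne, hF.mem_zero]
    · simp (disch := omega) only [Function.update_of_ne, hF.mem_one]
  · simp (disch := omega) only [update_of_eq, Nat.sub_zero]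
  · simp (disch := omega) only [Function.update_of_ne, update_of_eq, Nat.sub_zero]
  · simp (disch := omega) only [update_of_eq, Nat.sub_zero]
  · intro u hu1 hu2
    by_cases hu : u = k + 1
    · subst hu
      simp (disch := omega) only [Function.update_of_ne, update_of_eq, LTCode.stepProb, if_true]
    · simp (disch := omega) only [Function.update_of_ne, hs.join, LTCode.stepProb, if_neg,
        LTCode.one_sub_avoidTable hM]
  · intro j hj
    simp (disch := omega) only [Function.update_of_ne, hs.choose, LTCode.momentRow]

theorem runs_scaleProgram {k m : ℕ} {c : ℝ} {s : State} (hF : Frame k s)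
    (h4 : s.idx 4 = 2 * k + 13) (h6 : s.idx 6 = 2 * k + 13 + m + 1) (hpow : s.mem (k + 8) = 1)
    (hc : s.mem (k + 9) = c) :
    Runs scaleProgram s ((m + 1) * 4 + 1) fun s' =>
      (∀ r, r ≠ 4 → s'.idx r = s.idx r) ∧
      (∀ a, a ≠ k + 8 → a < 2 * k + 13 → s'.mem a = s.mem a) ∧
      ∀ j, j ≤ m → s'.mem (2 * k + 13 + j) = s.mem (2 * k + 13 + j) * c ^ j := by
  refine (Runs.while (B := 3) (fun i s' => (s'.idx 4 = 2 * k + 13 + i ∧ s'.mem (k + 8) = c ^ i) ∧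
      (∀ r, r ≠ 4 → s'.idx r = s.idx r) ∧
      (∀ a, a ≠ k + 8 → a < 2 * k + 13 ∨ 2 * k + 13 + i ≤ a → s'.mem a = s.mem a) ∧
      ∀ j, j < i → s'.mem (2 * k + 13 + j) = s.mem (2 * k + 13 + j) * c ^ j)
    (m + 1) ?_ ?_ ?_ ?_).mono le_rfl ?_
  · rintro i hi s' ⟨⟨i4, -⟩, hr, -⟩
    simp only [Test.Holds, i4, hr 6 (by omega), h6]
    omega
  · rintro i hi s' ⟨⟨i4, hp⟩, hr, hm, hj⟩
    have i1 : s'.idx 1 = 1 := by rw [hr 1 (by omega), hF.idx1]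
    have i16 : s'.idx 16 = k + 8 := by rw [hr 16 (by omega), hF.idx16]
    have i17 : s'.idx 17 = k + 9 := by rw [hr 17 (by omega), hF.idx17]
    have hc' : s'.mem (k + 9) = c := by rw [hm _ (by omega) (by omega), hc]
    have hv : s'.mem (2 * k + 13 + i) = s.mem (2 * k + 13 + i) := hm _ (by omega) (by omega)
    have hrun : [.memArith .mul 16 16 17, .idxAdd 4 4 1].foldl Instr.run
        (Instr.run s' (.memArith .mul 4 4 16)) =
        ⟨Function.update s'.idx 4 (2 * k + 13 + i + 1), Function.update (Function.update s'.mem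
          (2 * k + 13 + i) (s.mem (2 * k + 13 + i) * c ^ i)) (k + 8) (c ^ i * c)⟩ := by
      simp (disch := omega) only [List.foldl_cons, List.foldl_nil, Instr.run, ArithOp.eval,
        Function.update_of_ne, i1, i4, i16, i17, hc', hp, hv]
    refine Runs.block (by simp [BlockDefined, Instr.Defined]) ?_
    rw [hrun]
    refine ⟨⟨?_, ?_⟩, ?_, ?_, ?_⟩
    · simp (disch := omega) only [update_of_eq]
      omega
    · simp (disch := omega) only [update_of_eq, pow_succ]
    · intro r h4
      simp (disch := omega) only [Function.update_of_ne, hr]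
    · intro a ha1 ha2
      simp (disch := omega) only [Function.update_of_ne, hm]
    · intro j hji
      by_cases h : j = i
      · subst h
        simp (disch := omega) only [Function.update_of_ne, update_of_eq]
      · simp (disch := omega) only [Function.update_of_ne, hj]
  · rintro s' ⟨⟨i4, -⟩, hr, -⟩
    simp only [Test.Holds, i4, hr 6 (by omega), h6]
    omega
  · exact ⟨⟨h4, by rw [hpow, pow_zero]⟩, fun r _ => rfl, fun a _ _ => rfl, fun j _ => by omega⟩
  · rintro s' ⟨-, hr, hm, hj⟩
    exact ⟨hr, fun a h1 h2 => hm a h1 (by omega), fun j h => hj j (by omega)⟩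

/-- The invariant of `subtractProgram` after `i` passes from the state `s₀`: the cells `k + 4`,
`k + 5`, `k + 6` hold `m - i`, `i + 1` and `binom(m, i)`. -/
structure SubtractInv (k m : ℕ) (s₀ : State) (i : ℕ) (s : State) : Prop where
  idx4 : s.idx 4 = 2 * k + 13 + i
  rest : s.mem (k + 4) = (m : ℝ) - i
  next : s.mem (k + 5) = (i : ℝ) + 1
  binom : s.mem (k + 6) = m.choose i
  idx_eq : ∀ r, r ≠ 4 → s.idx r = s₀.idx r
  mem_eq : ∀ a, a < k + 4 ∨ k + 7 < a → a < 2 * k + 13 ∨ 2 * k + 13 + i ≤ a → s.mem a = s₀.mem a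
  done : ∀ j, j < i → s.mem (2 * k + 13 + j) =
    s₀.mem (2 * k + 13 + j) - m.choose j * s₀.mem (2 * k + 13 + m)

theorem runs_subtractBody {k m i : ℕ} {s₀ s : State} (hF : Frame k s₀)
    (h5 : s₀.idx 5 = 2 * k + 13 + m) (hi : i < m) (hs : SubtractInv k m s₀ i s) :
    Runs (.block (.memArith .mul 15 14 5) [.memArith .sub 4 4 15, .memArith .mul 14 14 12,
      .memArith .div 14 14 13, .memArith .sub 12 12 11, .memArith .add 13 13 11, .idxAdd 4 4 1])
      s 7 (SubtractInv k m s₀ (i + 1)) := by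
  have i1 : s.idx 1 = 1 := by rw [hs.idx_eq 1 (by omega), hF.idx1]
  have i5 : s.idx 5 = 2 * k + 13 + m := by rw [hs.idx_eq 5 (by omega), h5]
  have i11 : s.idx 11 = k + 3 := by rw [hs.idx_eq 11 (by omega), hF.idx11]
  have i12 : s.idx 12 = k + 4 := by rw [hs.idx_eq 12 (by omega), hF.idx12]
  have i13 : s.idx 13 = k + 5 := by rw [hs.idx_eq 13 (by omega), hF.idx13]
  have i14 : s.idx 14 = k + 6 := by rw [hs.idx_eq 14 (by omega), hF.idx14]
  have i15 : s.idx 15 = k + 7 := by rw [hs.idx_eq 15 (by omega), hF.idx15]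
  have i4 := hs.idx4
  have hrest := hs.rest
  have hnext := hs.next
  have hbin := hs.binom
  have hone : s.mem (k + 3) = 1 := by rw [hs.mem_eq _ (by omega) (by omega), hF.mem_one]
  have hv : s.mem (2 * k + 13 + i) = s₀.mem (2 * k + 13 + i) := hs.mem_eq _ (by omega) (by omega)
  have hlast : s.mem (2 * k + 13 + m) = s₀.mem (2 * k + 13 + m) :=
    hs.mem_eq _ (by omega) (by omega)
  have hch := choose_mul_div m i hi.le
  have hi0 : (i : ℝ) + 1 ≠ 0 := by positivity
  have hrun : [.memArith .sub 4 4 15, .memArith .mul 14 14 12, .memArith .div 14 14 13,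
      .memArith .sub 12 12 11, .memArith .add 13 13 11, .idxAdd 4 4 1].foldl Instr.run
        (Instr.run s (.memArith .mul 15 14 5)) =
      ⟨Function.update s.idx 4 (2 * k + 13 + i + 1),
        Function.update (Function.update (Function.update (Function.update (Function.update
          (Function.update s.mem (k + 7) (m.choose i * s₀.mem (2 * k + 13 + m)))
          (2 * k + 13 + i)
            (s₀.mem (2 * k + 13 + i) - m.choose i * s₀.mem (2 * k + 13 + m)))
          (k + 6) (m.choose i * (m - i))) (k + 6) (m.choose (i + 1)))
          (k + 4) (m - i - 1)) (k + 5) (i + 1 + 1)⟩ := by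
    simp (disch := omega) only [List.foldl_cons, List.foldl_nil, Instr.run, ArithOp.eval,
      Function.update_of_ne, update_of_eq, i1, i4, i5, i11, i12, i13, i14, i15, hone, hrest, hnext,
      hbin, hv, hlast, hch]
  refine Runs.block ?_ ?_
  · simp (disch := omega) only [BlockDefined, Instr.Defined, Instr.run, ArithOp.eval,
      Function.update_of_ne, i4, i5, i12, i13, i14, i15, hnext, ne_eq, hi0, not_false_eq_true,
      and_self]
  rw [hrun]
  constructor
  · simp (disch := omega) only [update_of_eq]
    omega
  · simp (disch := omega) only [Function.update_of_ne, update_of_eq]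
    push_cast
    ring
  · simp (disch := omega) only [update_of_eq]
    push_cast
    ring
  · simp (disch := omega) only [Function.update_of_ne, update_of_eq]
  · intro r hr
    simp (disch := omega) only [Function.update_of_ne, hs.idx_eq]
  · intro a ha1 ha2
    simp (disch := omega) only [Function.update_of_ne, hs.mem_eq]
  · intro j hj
    by_cases h : j = i
    · subst h
      simp (disch := omega) only [Function.update_of_ne, update_of_eq]
    · simp (disch := omega) only [Function.update_of_ne, hs.done]

theorem runs_subtractProgram {k m : ℕ} {s₀ : State} (hF : Frame k s₀)
    (h5 : s₀.idx 5 = 2 * k + 13 + m) (hs : SubtractInv k m s₀ 0 s₀) :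
    Runs subtractProgram s₀ (m * 8 + 1) (SubtractInv k m s₀ m) := by
  refine Runs.while (B := 7) (SubtractInv k m s₀) m ?_ ?_ ?_ hs
  · intro i hi s hs
    simp only [Test.Holds, hs.idx4, hs.idx_eq 5 (by omega), h5]
    omega
  · exact fun i hi s hs => runs_subtractBody hF h5 hi hs
  · intro s hs
    simp only [Test.Holds, hs.idx4, hs.idx_eq 5 (by omega), h5]
    omega

/-- The state within a step of the decoder, with the values `E j` in the cells `2 k + 13 + j` for
`j < m'`. -/
structure StepInv (k : ℕ) (n : ℝ) (Ω : ℕ → ℝ) (m : ℕ) (E : ℕ → ℝ) (m' : ℕ) (s : State) :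
    Prop where
  frame : Frame k s
  idx2 : s.idx 2 = m
  idx3 : s.idx 3 = m + 1
  rest : s.mem (k + 10) = m
  step : ∀ u, 1 ≤ u → u ≤ k + 1 → s.mem u = LTCode.stepProb k n Ω u
  moment : ∀ j, j < m' → s.mem (2 * k + 13 + j) = E j

theorem runs_stepScaleProgram {k : ℕ} {n : ℝ} {Ω : ℕ → ℝ} {m : ℕ} (hm : m ≤ k) {E : ℕ → ℝ}
    {s : State} (hs : StepInv k n Ω m E (m + 1) s) :
    Runs stepScaleProgram s (5 + ((m + 1) * 4 + 1)) fun s' =>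
      StepInv k n Ω m (fun j => E j * (1 - LTCode.stepProb k n Ω (m + 1)) ^ j) (m + 1) s' ∧
        s'.idx 5 = 2 * k + 13 + m := by
  have hF := hs.frame
  have h1 := hF.idx1
  have h2 := hs.idx2
  have h3 := hs.idx3
  have h9 := hF.idx9
  have h11 := hF.idx11
  have h16 := hF.idx16
  have h17 := hF.idx17
  have h20 := hF.idx20
  have hone := hF.mem_one
  have hstep : s.mem (m + 1) = LTCode.stepProb k n Ω (m + 1) := hs.step _ (by omega) (by omega)
  have hrun : [.memCopy 16 11, .idxAdd 4 20 9, .idxAdd 5 20 2, .idxAdd 6 5 1].foldl Instr.run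
      (Instr.run s (.memArith .sub 17 11 3)) =
      ⟨Function.update (Function.update (Function.update s.idx 4 (2 * k + 13))
        5 (2 * k + 13 + m)) 6 (2 * k + 13 + m + 1), Function.update (Function.update s.mem (k + 9)
        (1 - LTCode.stepProb k n Ω (m + 1))) (k + 8) 1⟩ := by
    simp (disch := omega) only [List.foldl_cons, List.foldl_nil, Instr.run, ArithOp.eval,
      Function.update_of_ne, update_of_eq, h1, h2, h3, h9, h11, h16, h17, h20, hone, hstep,
      add_zero]
  refine Runs.seq (B := 5) (φ := fun s' => s' = ⟨Function.update (Function.update (Function.update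
      s.idx 4 (2 * k + 13)) 5 (2 * k + 13 + m)) 6 (2 * k + 13 + m + 1),
      Function.update (Function.update s.mem (k + 9) (1 - LTCode.stepProb k n Ω (m + 1)))
        (k + 8) 1⟩)
    (Runs.block (by simp [BlockDefined, Instr.Defined]) hrun) ?_
  rintro _ rfl
  refine (runs_scaleProgram (k := k) (m := m) (c := 1 - LTCode.stepProb k n Ω (m + 1))
    ?_ ?_ ?_ ?_ ?_).mono le_rfl ?_
  · constructor
    · intro r hr
      simp (disch := omega) only [Function.update_of_ne, hF.idx]
    · simp (disch := omega) only [Function.update_of_ne, hF.mem_zero]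
    · simp (disch := omega) only [Function.update_of_ne, hF.mem_one]
  · simp (disch := omega) only [Function.update_of_ne, update_of_eq]
  · simp (disch := omega) only [update_of_eq]
  · simp (disch := omega) only [update_of_eq]
  · simp (disch := omega) only [Function.update_of_ne, update_of_eq]
  rintro s₁ ⟨hr₁, hm₁, hj₁⟩
  have idx₁ : ∀ r, r < 4 ∨ 6 < r → s₁.idx r = s.idx r := by
    intro r hr
    rw [hr₁ r (by omega)]
    simp (disch := omega) only [Function.update_of_ne]
  have mem₁ : ∀ a, a < k + 8 ∨ k + 9 < a → a < 2 * k + 13 → s₁.mem a = s.mem a := by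
    intro a ha1 ha2
    rw [hm₁ a (by omega) ha2]
    simp (disch := omega) only [Function.update_of_ne]
  refine ⟨⟨⟨fun r hr => ?_, ?_, ?_⟩, ?_, ?_, ?_, fun u hu1 hu2 => ?_, fun j hj => ?_⟩, ?_⟩
  · rw [idx₁ r (by omega), hF.idx r hr]
  · rw [mem₁ _ (by omega) (by omega), hF.mem_zero]
  · rw [mem₁ _ (by omega) (by omega), hF.mem_one]
  · rw [idx₁ _ (by omega), h2]
  · rw [idx₁ _ (by omega), h3]
  · rw [mem₁ _ (by omega) (by omega), hs.rest]
  · rw [mem₁ _ (by omega) (by omega), hs.step u hu1 hu2]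
  · rw [hj₁ j (by omega)]
    simp (disch := omega) only [Function.update_of_ne, hs.moment]
  · rw [hr₁ 5 (by omega)]
    simp (disch := omega) only [Function.update_of_ne, update_of_eq]

theorem runs_stepSubtractProgram {k : ℕ} {n : ℝ} {Ω : ℕ → ℝ} {m : ℕ} (hm : m ≤ k) {E : ℕ → ℝ}
    {s : State} (hs : StepInv k n Ω m E (m + 1) s) (h5 : s.idx 5 = 2 * k + 13 + m) :
    Runs stepSubtractProgram s (4 + (m * 8 + 1))
      (StepInv k n Ω m (fun j => E j - m.choose j * E m) m) := by
  have hF := hs.frame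
  have h9 := hF.idx9
  have h11 := hF.idx11
  have h12 := hF.idx12
  have h13 := hF.idx13
  have h14 := hF.idx14
  have h18 := hF.idx18
  have h20 := hF.idx20
  have hone := hF.mem_one
  have hrest := hs.rest
  have hrun : [.memCopy 12 18, .memCopy 13 11, .memCopy 14 11].foldl Instr.run
      (Instr.run s (.idxAdd 4 20 9)) = ⟨Function.update s.idx 4 (2 * k + 13),
        Function.update (Function.update (Function.update s.mem (k + 4) m) (k + 5) 1)
          (k + 6) 1⟩ := by
    simp (disch := omega) only [List.foldl_cons, List.foldl_nil, Instr.run,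
      Function.update_of_ne, h9, h11, h12, h13, h14, h18, h20, hone, hrest, add_zero]
  refine Runs.seq (B := 4) (φ := fun s' => s' = ⟨Function.update s.idx 4 (2 * k + 13),
      Function.update (Function.update (Function.update s.mem (k + 4) m) (k + 5) 1) (k + 6) 1⟩)
    (Runs.block (by simp [BlockDefined, Instr.Defined]) hrun) ?_
  rintro _ rfl
  refine (runs_subtractProgram (k := k) (m := m) ?_ ?_ ?_).mono le_rfl fun s₂ hs₂ => ?_
  · constructor
    · intro r hr
      simp (disch := omega) only [Function.update_of_ne, hF.idx]
    · simp (disch := omega) only [Function.update_of_ne, hF.mem_zero]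
    · simp (disch := omega) only [Function.update_of_ne, hone]
  · simp (disch := omega) only [Function.update_of_ne, h5]
  · constructor
    · simp (disch := omega) only [update_of_eq, add_zero]
    · simp (disch := omega) only [Function.update_of_ne, update_of_eq, Nat.cast_zero, sub_zero]
    · simp (disch := omega) only [Function.update_of_ne, update_of_eq, Nat.cast_zero, zero_add]
    · simp (disch := omega) only [update_of_eq, Nat.choose_zero_right, Nat.cast_one]
    · exact fun r _ => rfl
    · exact fun a _ _ => rfl
    · exact fun j hj => by omega
  have idx₂ : ∀ r, r < 4 ∨ 6 < r → s₂.idx r = s.idx r := by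
    intro r hr
    rw [hs₂.idx_eq r (by omega)]
    simp (disch := omega) only [Function.update_of_ne]
  have mem₂ : ∀ a, a < k + 4 ∨ k + 7 < a → a < 2 * k + 13 → s₂.mem a = s.mem a := by
    intro a ha1 ha2
    rw [hs₂.mem_eq a (by omega) (by omega)]
    simp (disch := omega) only [Function.update_of_ne]
  refine ⟨⟨fun r hr => ?_, ?_, ?_⟩, ?_, ?_, ?_, fun u hu1 hu2 => ?_, fun j hj => ?_⟩
  · rw [idx₂ r (by omega), hF.idx r hr]
  · rw [mem₂ _ (by omega) (by omega), hF.mem_zero]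
  · rw [mem₂ _ (by omega) (by omega), hF.mem_one]
  · rw [idx₂ _ (by omega), hs.idx2]
  · rw [idx₂ _ (by omega), hs.idx3]
  · rw [mem₂ _ (by omega) (by omega), hrest]
  · rw [mem₂ _ (by omega) (by omega), hs.step u hu1 hu2]
  · rw [hs₂.done j hj]
    simp (disch := omega) only [Function.update_of_ne, hs.moment]

theorem runs_stepProgram {k : ℕ} {n : ℝ} {Ω : ℕ → ℝ} {i : ℕ} (hi : i < k) {s : State}
    (hs : MomentInv k n Ω i s) :
    Runs stepProgram s (12 * k + 18) (MomentInv k n Ω (i + 1)) := by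
  refine (Runs.seq (runs_stepScaleProgram (m := k - i) (by omega) ⟨hs.frame, hs.idx2, hs.idx3,
    hs.rest, hs.step, fun j hj => hs.moment j (by omega)⟩) fun s₁ hs₁ =>
    Runs.seq (runs_stepSubtractProgram (by omega) hs₁.1 hs₁.2) (B' := 3) fun s hs => ?_).mono
    (by omega) fun _ h => h
  have hF := hs.frame
  have h1 := hF.idx1
  have h2 := hs.idx2
  have h3 := hs.idx3
  have h11 := hF.idx11
  have h18 := hF.idx18
  have hone := hF.mem_one
  have hrest := hs.rest
  have hrun : [.idxSub 2 2 1, .idxSub 3 3 1].foldl Instr.run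
      (Instr.run s (.memArith .sub 18 18 11)) =
      ⟨Function.update (Function.update s.idx 2 (k - i - 1)) 3 (k - i + 1 - 1),
        Function.update s.mem (k + 10) (((k - i : ℕ) : ℝ) - 1)⟩ := by
    simp (disch := omega) only [List.foldl_cons, List.foldl_nil, Instr.run, ArithOp.eval,
      Function.update_of_ne, h1, h2, h3, h11, h18, hone, hrest]
  refine Runs.block (by simp [BlockDefined, Instr.Defined]) ?_
  rw [hrun]
  constructor
  · constructor
    · intro r hr
      simp (disch := omega) only [Function.update_of_ne, hF.idx]
    · simp (disch := omega) only [Function.update_of_ne, hF.mem_zero]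
    · simp (disch := omega) only [Function.update_of_ne, hone]
  · simp (disch := omega) only [Function.update_of_ne, update_of_eq]
    omega
  · simp (disch := omega) only [update_of_eq]
    omega
  · simp (disch := omega) only [update_of_eq]
    rw [show k - (i + 1) = k - i - 1 by omega, Nat.cast_sub (by omega : 1 ≤ k - i), Nat.cast_one]
  · intro u hu1 hu2
    simp (disch := omega) only [Function.update_of_ne, hs.step]
  · intro j hj
    simp (disch := omega) only [Function.update_of_ne, hs.moment, LTCode.momentRow]

theorem runs_errorProgram {k : ℕ} {n : ℝ} {Ω : ℕ → ℝ} (hM : LTCode.IsPoissonModel k n Ω) :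
    Runs errorProgram (inputState k n Ω)
      (4 * LTCode.maxDegree k Ω * k + 12 * k ^ 2 + 42 * k + 41)
      fun s => s.mem 0 = 1 - LTCode.momentRow k (LTCode.stepProb k n Ω) k 0 := by
  refine (Runs.seq (runs_joinProgram hM) fun s hs => Runs.seq (runs_momentInit hM hs)
    (B' := k * (12 * k + 18 + 1) + 1 + 1) fun s hs => Runs.seq
      (Runs.while (B := 12 * k + 18) (MomentInv k n Ω) k ?_ ?_ ?_ hs) ?_).mono (le_of_eq (by ring))
    fun _ h => h
  · intro i hi s hs
    simp only [Test.Holds, hs.frame.idx9, hs.idx2]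
    omega
  · exact fun i hi s hs => runs_stepProgram hi hs
  · intro s hs
    simp only [Test.Holds, hs.frame.idx9, hs.idx2]
    omega
  · intro s hs
    have hF := hs.frame
    refine Runs.block (l := []) (by simp [BlockDefined, Instr.Defined]) ?_
    simp only [List.foldl_nil, Instr.run, ArithOp.eval, hF.idx9, hF.idx11, hF.idx20, hF.mem_one,
      Function.update_self]
    rw [← hs.moment 0 (Nat.zero_le _), add_zero]

end RealRAM

/-! ### Comparison of the orders of growth -/

theorem sq_mul_log_isLittleO (ν : ℕ → ℝ) (hν : ∀ k : ℕ, (k : ℝ) ≤ ν k) :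
    (fun k : ℕ => (k : ℝ) ^ 2 * Real.log k)
      =o[Filter.atTop] fun k : ℕ => ν k ^ 3 * Real.log (ν k) ^ 2 := by
  have h1 : (fun k : ℕ => (k : ℝ) ^ 2 * Real.log k)
      =o[Filter.atTop] fun k : ℕ => (k : ℝ) ^ 3 * Real.log k := by
    have h2 : (fun _ : ℕ => (1 : ℝ)) =o[Filter.atTop] fun k : ℕ => (k : ℝ) :=
      (Asymptotics.isLittleO_const_left.mpr
        (Or.inr (tendsto_norm_atTop_atTop.comp tendsto_natCast_atTop_atTop)))
    refine (h2.mul_isBigO (Asymptotics.isBigO_refl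
      (fun k : ℕ => (k : ℝ) ^ 2 * Real.log k) Filter.atTop)).congr (fun k => by ring)
      fun k => by ring
  refine h1.trans_isBigO (Asymptotics.IsBigO.of_bound 1 ?_)
  filter_upwards [Filter.eventually_ge_atTop 3] with k hk
  have hk3 : (3 : ℝ) ≤ k := by exact_mod_cast hk
  have hlog1 : 1 ≤ Real.log k := by
    rw [Real.le_log_iff_exp_le (by linarith)]
    linarith [Real.exp_one_lt_d9]
  have hlog : Real.log k ≤ Real.log (ν k) := Real.log_le_log (by linarith) (hν k)
  have hlog2 : Real.log k ≤ Real.log (ν k) ^ 2 := by nlinarith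
  rw [one_mul, Real.norm_of_nonneg (mul_nonneg (by positivity) (by linarith)),
    Real.norm_of_nonneg (mul_nonneg (pow_nonneg (by linarith [hν k]) 3) (sq_nonneg _))]
  have h3 : (k : ℝ) ^ 3 ≤ ν k ^ 3 := pow_le_pow_left₀ (by linarith) (hν k) 3
  exact mul_le_mul h3 hlog2 (by linarith) (pow_nonneg (by linarith [hν k]) 3)

theorem mainTheorem2 :
    -- the generating polynomials
    (∀ (k : ℕ) (n : ℝ) (Ω : ℕ → ℝ) (sel : Finset (Fin k) → Finset (Fin k) → Fin k),
      1 ≤ k → LTCode.IsPoissonModel k n Ω → LTCode.IsSelectionRule sel →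
        (∀ x : ℝ, x ≠ 0 →
          (LTCode.genPoly k n Ω sel k).eval x =
            1 / x * ((LTCode.recvProb k n Ω 1 * x + (1 - LTCode.recvProb k n Ω 1)) ^ k
              - (1 - LTCode.recvProb k n Ω 1) ^ k)) ∧
        (∀ u : ℕ, 1 ≤ u → u ≤ k → ∀ x : ℝ, x ≠ 0 →
          LTCode.joinProb k n Ω u * x + (1 - LTCode.joinProb k n Ω u) ≠ 0 →
          (LTCode.genPoly k n Ω sel (u - 1)).eval x =
            (LTCode.joinProb k n Ω u * x + (1 - LTCode.joinProb k n Ω u)) ^ (u - 1) / x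
              * (LTCode.genPoly k n Ω sel u).eval
                  (x / (LTCode.joinProb k n Ω u * x + (1 - LTCode.joinProb k n Ω u)))
            - (1 - LTCode.joinProb k n Ω u) ^ (u - 1) / x
              * (LTCode.genPoly k n Ω sel u).eval 0) ∧
        LTCode.errorProb k n Ω sel = LTCode.Q k n Ω sel 1 0 ∧
        LTCode.genPoly k n Ω sel 1 = Polynomial.C (1 - LTCode.errorProb k n Ω sel)) ∧
    -- the precomputation of `q_1, …, q_k`
    (∃ (P : RealRAM.Program) (c : ℝ), ∀ (k : ℕ) (n : ℝ) (Ω : ℕ → ℝ),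
      1 ≤ k → LTCode.IsPoissonModel k n Ω →
        ∃ (t : ℕ) (s : RealRAM.State),
          RealRAM.Exec P (RealRAM.inputState k n Ω) t s ∧
          (∀ u : ℕ, 1 ≤ u → u ≤ k → s.mem u = LTCode.joinProb k n Ω u) ∧
          (2 ≤ k → (t : ℝ) ≤ c * (LTCode.maxDegree k Ω * k * Real.log k))) ∧
    -- the algorithm for the error probability
    (∃ (P : RealRAM.Program) (c : ℝ), ∀ (k : ℕ) (n : ℝ) (Ω : ℕ → ℝ),
      1 ≤ k → LTCode.IsPoissonModel k n Ω →
        ∃ (t : ℕ) (s : RealRAM.State),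
          RealRAM.Exec P (RealRAM.inputState k n Ω) t s ∧
          (∀ sel : Finset (Fin k) → Finset (Fin k) → Fin k, LTCode.IsSelectionRule sel →
            s.mem 0 = LTCode.errorProb k n Ω sel) ∧
          (2 ≤ k → (t : ℝ) ≤ c * ((k : ℝ) ^ 2 * Real.log k))) ∧
    -- the bound is of smaller order than `n ^ 3 * (log n) ^ 2` when `n ≥ k`
    (∀ ν : ℕ → ℝ, (∀ k : ℕ, (k : ℝ) ≤ ν k) →
      (fun k : ℕ => (k : ℝ) ^ 2 * Real.log k)
        =o[Filter.atTop] fun k : ℕ => ν k ^ 3 * Real.log (ν k) ^ 2) := by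
  -- `log k ≥ 1/2` absorbs the lower-order terms `4 D k + 23 k + 34 ≤ 61 D k` and
  -- `4 D k + 12 k² + 42 k + 41 ≤ 99 k²` of the operation counts.
  have hlog : ∀ k : ℕ, 2 ≤ k → (1 : ℝ) / 2 ≤ Real.log k := fun k hk => by
    have h2 : Real.log 2 ≤ Real.log k :=
      Real.log_le_log (by norm_num) (by exact_mod_cast hk)
    linarith [Real.log_two_gt_d9]
  refine ⟨fun k n Ω sel hk hM hsel => ⟨fun x hx => LTCode.genPoly_initial hsel hx,
    fun u h1 hu x hx hq => LTCode.genPoly_step hM hsel h1 hu hx hq, LTCode.errorProb_eq hsel hk,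
    LTCode.genPoly_one hsel hk⟩, ⟨RealRAM.joinProgram, 122, fun k n Ω hk hM => ?_⟩,
    ⟨RealRAM.errorProgram, 198, fun k n Ω hk hM => ?_⟩, sq_mul_log_isLittleO⟩
  · obtain ⟨t, s, hE, ht, hs⟩ := RealRAM.runs_joinProgram hM
    refine ⟨t, s, hE, fun u h1 hu => ?_, fun h2 => ?_⟩
    · rw [hs.join u (by omega) hu, LTCode.one_sub_avoidTable hM]
    · have hD : (1 : ℝ) ≤ LTCode.maxDegree k Ω := by exact_mod_cast LTCode.one_le_maxDegree hM
      have hk' : (1 : ℝ) ≤ k := by exact_mod_cast hk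
      have ht' : (t : ℝ) ≤ 4 * LTCode.maxDegree k Ω * k + 23 * k + 34 := by exact_mod_cast ht
      have hDk : (k : ℝ) ≤ LTCode.maxDegree k Ω * k := le_mul_of_one_le_left (by linarith) hD
      have := mul_le_mul_of_nonneg_left (hlog k h2)
        (by linarith : (0 : ℝ) ≤ LTCode.maxDegree k Ω * k)
      linarith
  · obtain ⟨t, s, hE, ht, hs⟩ := RealRAM.runs_errorProgram hM
    refine ⟨t, s, hE, fun sel hsel => ?_, fun h2 => ?_⟩
    · rw [hs, LTCode.momentRow_eq_success hM hsel hk, sub_sub_cancel]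
    · have hD : (LTCode.maxDegree k Ω : ℝ) ≤ k := by exact_mod_cast LTCode.maxDegree_le k Ω
      have hk' : (1 : ℝ) ≤ k := by exact_mod_cast hk
      have ht' : (t : ℝ) ≤ 4 * LTCode.maxDegree k Ω * k + 12 * k ^ 2 + 42 * k + 41 := by
        exact_mod_cast ht
      have hDk : (LTCode.maxDegree k Ω : ℝ) * k ≤ k ^ 2 := by
        rw [sq]
        exact mul_le_mul_of_nonneg_right hD (by linarith)
      have hkk : (k : ℝ) ≤ k ^ 2 := by
        rw [sq]
        exact le_mul_of_one_le_left (by linarith) hk'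
      have := mul_le_mul_of_nonneg_left (hlog k h2) (by positivity : (0 : ℝ) ≤ (k : ℝ) ^ 2)
      linarith
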